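/- Let $V$ be an oriented real vector space of finite dimension $r$, with orientation $o$, dual space $V^*$, and symmetric algebras $S(V)$ (polynomial functions on $V^*$) and $S(V^*)$ (polynomial functions on $V$). Let $\Delta\subset V\setminus\{0\}$ be a finite set that spans $V$ and satisfies $\Delta=-\Delta$. Let $R_\Delta=\Delta^{-1}S(V)$, on which $S(V^*)$ acts by differential operators with constant coefficients, $P\mapsto P(\partial)$. Let $G_\Delta\subset R_\Delta$ be the ($S(V^*)$-stable) linear span of the functions $1/\prod_{\alpha\in\kappa}\alpha^{n_\alpha}$, where $\kappa\subset\Delta$ generates $V$ and all $n_\alpha$ are positive integers. A basis of $\Delta$ is a subset $\sigma\subset\Delta$ that is a basis of $V$; put $\phi_\sigma=1/\prod_{\alpha\in\sigma}\alpha$, let $C(\sigma)\subset V$ be the closed convex cone generated by $\sigma$, and let $[C(\sigma)]$ be its characteristic function. A wall is a hyperplane of $V$ generated by $r-1$ linearly independent elements of $\Delta$; $V_{reg,\Delta}$ is the complement of the union of the walls, and $\mathcal P_\Delta$ is the space of functions on $V_{reg,\Delta}$ that are given by a polynomial function on each connected component; $S(V^*)$ acts on it by multiplication. Let $\delta$ be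 a chamber, that is, a connected component of $V^*\setminus\bigcup_{\alpha\in\Delta}\{z:\langle\alpha,z\rangle=0\}$, let $\delta^\vee=\{h\in V:\langle y,h\rangle\ge 0\text{ for all }y\in\delta\}$, and let $\mathcal P_\Delta(\delta)\subset\mathcal P_\Delta$ be the subspace spanned by the functions $f\,[C(\sigma)]$ (restricted to $V_{reg,\Delta}$) with $f\in S(V^*)$ and $\sigma$ a basis of $\Delta$ such that $C(\sigma)\subset\delta^\vee$. For $dh\in\wedge^rV^*$, write $\int_{V,o}\varphi(h)\,dh$ for the integral of a form of top degree over the oriented space $V$. If $dh$ is positive with respect to $o$, let $\operatorname{vol}(\sigma,dh)=|dh(\alpha_1,\dots,\alpha_r)|$ be the volume of the parallelepiped on $\sigma=\{\alpha_1,\dots,\alpha_r\}$. **Theorem.** For each $F\in\mathcal P_\Delta(\delta)$ there is a unique element $L^o_\delta(F)\in G_\Delta\otimes\wedge^{r}V$, the Laplace transform of $F$, such that for all $dh\in\wedge^rV^*$ and all $y\in\delta$ the integral below converges absolutely and $$\langle L^o_\delta(F),dh\rangle(y)=\int_{V,o}e^{-\langle y,h\rangle}F(h)\,dh .$$ The map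 $$L^o_\delta:\mathcal P_\Delta(\delta)\to G_\Delta\otimes\wedge^{r}V$$ is an isomorphism of real vector spaces, and it commutes with the actions of $S(V^*)$ up to the automorphism $P(h)\mapsto P(-h)$: for all $P\in S(V^*)$ and $F\in\mathcal P_\Delta(\delta)$, $$L^o_\delta(P\,F)=\bigl(P(-\partial)\otimes 1\bigr)\,L^o_\delta(F).$$ Moreover, for every $dh\in\wedge^rV^*$ that is positive with respect to $o$ and every basis $\sigma$ of $\Delta$ with $C(\sigma)\subset\delta^\vee$, $$\langle L^o_\delta[C(\sigma)],dh\rangle=\operatorname{vol}(\sigma,dh)\,\phi_\sigma ,$$ that is, for all $y\in\delta$, the following integral converges and $$\int_{C(\sigma),o}e^{-\langle y,h\rangle}\,dh=\operatorname{vol}(\sigma,dh)\,\phi_\sigma(y).$$ -/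

import Mathlib

noncomputable section

namespace HypArr

open MeasureTheory Module TensorProduct

/-! ## The ring `R_Δ`, differentiation, and the space `G_Δ` -/

section Algebraic

variable {V : Type*} [NormedAddCommGroup V] [NormedSpace ℝ V]

/-- The polynomial function on `V*` defined by an element of `S(V)`, evaluated at `y`. -/
def evalDual (y : StrongDual ℝ V) : SymmetricAlgebra ℝ V →ₐ[ℝ] ℝ :=
  SymmetricAlgebra.lift (y : V →ₗ[ℝ] ℝ)

/-- The polynomial function on `V` defined by an element of `S(V*)`, evaluated at `h`. -/
def evalPrimal (h : V) : SymmetricAlgebra ℝ (StrongDual ℝ V) →ₐ[ℝ] ℝ :=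
  SymmetricAlgebra.lift
    { toFun := fun z => z h
      map_add' := fun _ _ => rfl
      map_smul' := fun _ _ => rfl }

/-- The automorphism `P(h) ↦ P(-h)` of `S(V*)`. -/
def negSubst : SymmetricAlgebra ℝ (StrongDual ℝ V) →ₐ[ℝ] SymmetricAlgebra ℝ (StrongDual ℝ V) :=
  SymmetricAlgebra.lift (-SymmetricAlgebra.ι ℝ (StrongDual ℝ V))

theorem evalPrimal_negSubst (h : V) (P : SymmetricAlgebra ℝ (StrongDual ℝ V)) :
    evalPrimal h (negSubst P) = evalPrimal (-h) P := by
  have : (evalPrimal h).comp negSubst = evalPrimal (V := V) (-h) := by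
    apply SymmetricAlgebra.algHom_ext
    ext z
    simp [negSubst, evalPrimal]
  exact congrArg (fun g => g P) this

/-- The multiplicative subset of `S(V)` generated by the linear functions `α ∈ Δ`. -/
abbrev denominators (Δ : Finset V) : Submonoid (SymmetricAlgebra ℝ V) :=
  Submonoid.closure (SymmetricAlgebra.ι ℝ V '' (Δ : Set V))

/-- `R_Δ = Δ⁻¹ S(V)`. -/
def RDelta (Δ : Finset V) : Type _ := Localization (denominators Δ)

instance (Δ : Finset V) : CommRing (RDelta Δ) :=
  inferInstanceAs (CommRing (Localization (denominators Δ)))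

instance (Δ : Finset V) : Algebra (SymmetricAlgebra ℝ V) (RDelta Δ) :=
  inferInstanceAs (Algebra (SymmetricAlgebra ℝ V) (Localization (denominators Δ)))

instance (Δ : Finset V) : IsLocalization (denominators Δ) (RDelta Δ) :=
  inferInstanceAs (IsLocalization (denominators Δ) (Localization (denominators Δ)))

instance (Δ : Finset V) : Algebra ℝ (RDelta Δ) :=
  ((algebraMap (SymmetricAlgebra ℝ V) (RDelta Δ)).comp
    (algebraMap ℝ (SymmetricAlgebra ℝ V))).toAlgebra

instance (Δ : Finset V) : IsScalarTower ℝ (SymmetricAlgebra ℝ V) (RDelta Δ) :=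
  IsScalarTower.of_algebraMap_eq fun _ => rfl

/-- The vector `v ∈ V`, seen as a linear function on `V*`, as an element of `R_Δ`. -/
def lin (Δ : Finset V) : V →ₗ[ℝ] RDelta Δ :=
  (IsScalarTower.toAlgHom ℝ (SymmetricAlgebra ℝ V) (RDelta Δ)).toLinearMap ∘ₗ
    SymmetricAlgebra.ι ℝ V

theorem isUnit_lin {Δ : Finset V} {α : V} (hα : α ∈ Δ) : IsUnit (lin Δ α) :=
  IsLocalization.map_units (RDelta Δ)
    (⟨SymmetricAlgebra.ι ℝ V α, Submonoid.subset_closure ⟨α, hα, rfl⟩⟩ : denominators Δ)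

/-- `V*_{reg,Δ}`: the complement in `V*` of the hyperplanes `⟨α, z⟩ = 0`, `α ∈ Δ`. -/
def regDual (Δ : Finset V) : Set (StrongDual ℝ V) := {y | ∀ α ∈ Δ, y α ≠ 0}

theorem isUnit_evalDual {Δ : Finset V} {y : StrongDual ℝ V} (hy : y ∈ regDual Δ)
    (d : denominators Δ) : IsUnit (evalDual y (d : SymmetricAlgebra ℝ V)) := by
  obtain ⟨d, hd⟩ := d
  induction hd using Submonoid.closure_induction with
  | mem x hx =>
    obtain ⟨α, hα, rfl⟩ := hx
    simpa [evalDual] using hy α hα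
  | one => simp
  | mul a b _ _ ha hb => simpa using And.intro (by simpa using ha) (by simpa using hb)

/-- The value of a rational function `φ ∈ R_Δ` at a regular point `y ∈ V*_{reg,Δ}`. -/
def evalR {Δ : Finset V} (y : regDual Δ) : RDelta Δ →ₐ[ℝ] ℝ :=
  IsLocalization.liftAlgHom (M := denominators Δ) (f := evalDual (y : StrongDual ℝ V))
    (isUnit_evalDual y.2)

theorem evalR_lin {Δ : Finset V} (y : regDual Δ) (v : V) :
    evalR y (lin Δ v) = (y : StrongDual ℝ V) v := by
  simp [evalR, lin, evalDual]

/-- The substitution homomorphism `v ↦ v + ⟨z, v⟩ t`, that is `f(y) ↦ f(y + t z)`, on `S(V)`. -/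
def taylorS (Δ : Finset V) (z : StrongDual ℝ V) :
    SymmetricAlgebra ℝ V →ₐ[ℝ] PowerSeries (RDelta Δ) :=
  SymmetricAlgebra.lift
    { toFun := fun v => PowerSeries.C (lin Δ v) +
        PowerSeries.C (algebraMap ℝ (RDelta Δ) (z v)) * PowerSeries.X
      map_add' := fun v w => by simp only [map_add]; ring
      map_smul' := fun c v => by
        have h1 : c • lin Δ v = algebraMap ℝ (RDelta Δ) c * lin Δ v := Algebra.smul_def _ _
        simp only [map_smul, smul_eq_mul, h1, map_mul, Algebra.smul_def, RingHom.id_apply,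
          PowerSeries.algebraMap_apply]
        ring }

theorem constCoeff_taylorS (Δ : Finset V) (z : StrongDual ℝ V) (s : SymmetricAlgebra ℝ V) :
    PowerSeries.constantCoeff (taylorS Δ z s) = algebraMap _ (RDelta Δ) s := by
  induction s using SymmetricAlgebra.induction with
  | algebraMap r =>
    rw [← IsScalarTower.algebraMap_apply ℝ (SymmetricAlgebra ℝ V) (RDelta Δ), AlgHom.commutes]
    simp [PowerSeries.algebraMap_apply]
  | ι x => simp [taylorS, lin]
  | mul a b ha hb => simp [ha, hb]
  | add a b ha hb => simp [ha, hb]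

/-- The Taylor expansion homomorphism `φ(y) ↦ φ(y + t z)` on `R_Δ`, with values in the formal
power series in `t` over `R_Δ`. -/
def taylor (Δ : Finset V) (z : StrongDual ℝ V) : RDelta Δ →ₐ[ℝ] PowerSeries (RDelta Δ) :=
  IsLocalization.liftAlgHom (M := denominators Δ) (f := taylorS Δ z) (fun d => by
    rw [PowerSeries.isUnit_iff_constantCoeff, constCoeff_taylorS]
    exact IsLocalization.map_units _ d)

theorem constCoeff_taylor (Δ : Finset V) (z : StrongDual ℝ V) (φ : RDelta Δ) :
    PowerSeries.constantCoeff (taylor Δ z φ) = φ := by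
  have : (PowerSeries.constantCoeff (R := RDelta Δ)).comp (taylor Δ z : RDelta Δ →+* _) =
      RingHom.id _ := by
    apply IsLocalization.ringHom_ext (denominators Δ)
    refine RingHom.ext fun s => ?_
    simp [taylor, constCoeff_taylorS]
  exact congrArg (fun g => g φ) this

/-- The derivation `∂(z)` of `R_Δ` in the direction `z ∈ V*`: the coefficient of `t` in
`φ(y + t z)`. It is the unique derivation with `∂(z) v = ⟨z, v⟩` for `v ∈ V`. -/
def deriv (Δ : Finset V) (z : StrongDual ℝ V) : Derivation ℝ (RDelta Δ) (RDelta Δ) :=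
  Derivation.mk'
    { toFun := fun φ => PowerSeries.coeff 1 (taylor Δ z φ)
      map_add' := fun a b => by simp
      map_smul' := fun c a => by simp }
    (fun a b => by
      simp only [LinearMap.coe_mk, AddHom.coe_mk, map_mul, smul_eq_mul, PowerSeries.coeff_mul]
      rw [Finset.Nat.antidiagonal_succ]
      simp [constCoeff_taylor]
      ring)

theorem deriv_lin (Δ : Finset V) (z : StrongDual ℝ V) (v : V) :
    deriv Δ z (lin Δ v) = algebraMap ℝ (RDelta Δ) (z v) := by
  simp [deriv, lin, taylor, taylorS, PowerSeries.coeff_C]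

theorem derivation_ext {Δ : Finset V} {D₁ D₂ : Derivation ℝ (RDelta Δ) (RDelta Δ)}
    (h : ∀ v, D₁ (lin Δ v) = D₂ (lin Δ v)) : D₁ = D₂ := by
  have hS : ∀ s : SymmetricAlgebra ℝ V,
      D₁ (algebraMap _ (RDelta Δ) s) = D₂ (algebraMap _ (RDelta Δ) s) := by
    intro s
    induction s using SymmetricAlgebra.induction with
    | algebraMap r =>
      rw [← IsScalarTower.algebraMap_apply ℝ (SymmetricAlgebra ℝ V) (RDelta Δ)]; simp
    | ι x => exact h x
    | mul a b ha hb => simp [ha, hb]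
    | add a b ha hb => simp [ha, hb]
  ext φ
  obtain ⟨⟨s, d⟩, hsd⟩ := IsLocalization.surj (denominators Δ) φ
  have hu := IsLocalization.map_units (RDelta Δ) d
  have h1 := congrArg D₁ hsd
  have h2 := congrArg D₂ hsd
  simp only [Derivation.leibniz, hS, smul_eq_mul] at h1 h2
  rw [← h2] at h1
  exact hu.mul_left_cancel (add_left_cancel h1)

theorem deriv_comm (Δ : Finset V) (z w : StrongDual ℝ V) (φ : RDelta Δ) :
    deriv Δ z (deriv Δ w φ) = deriv Δ w (deriv Δ z φ) := by
  have : ⁅deriv Δ z, deriv Δ w⁆ = 0 := derivation_ext fun v => by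
    simp [Derivation.commutator_apply, deriv_lin]
  have := congrArg (fun D => D φ) this
  simpa [Derivation.commutator_apply, sub_eq_zero] using this

/-- `z ↦ ∂(z)` as a linear map into the endomorphisms of `R_Δ`. -/
def derivEnd (Δ : Finset V) : StrongDual ℝ V →ₗ[ℝ] Module.End ℝ (RDelta Δ) where
  toFun z := (deriv Δ z : RDelta Δ →ₗ[ℝ] RDelta Δ)
  map_add' z w := by
    have : deriv Δ (z + w) = deriv Δ z + deriv Δ w := derivation_ext fun v => by
      simp [deriv_lin]
    rw [this]; rfl
  map_smul' c z := by
    have : deriv Δ (c • z) = c • deriv Δ z := derivation_ext fun v => by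
      simp [deriv_lin, -map_smul, ← Algebra.smul_def]
    rw [this]; rfl

/-- The action of `S(V*)` on `R_Δ` by differential operators with constant coefficients: the
algebra homomorphism `P ↦ P(∂)` with `z ↦ ∂(z)` for `z ∈ V*`. -/
def diffOp (Δ : Finset V) :
    SymmetricAlgebra ℝ (StrongDual ℝ V) →ₐ[ℝ] Module.End ℝ (RDelta Δ) :=
  RingCon.liftₐ (TensorAlgebra.symRingCon ℝ (StrongDual ℝ V))
    (TensorAlgebra.lift ℝ (derivEnd Δ))
    (RingCon.ringConGen_le.2 (fun x y h => by
      induction h with | mul_comm x y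
      rw [RingCon.ker_apply]
      ext φ
      simpa [derivEnd] using deriv_comm Δ x y φ))

theorem diffOp_ι (Δ : Finset V) (z : StrongDual ℝ V) (φ : RDelta Δ) :
    diffOp Δ (SymmetricAlgebra.ι ℝ (StrongDual ℝ V) z) φ = deriv Δ z φ := by
  simp [diffOp, SymmetricAlgebra.ι, derivEnd]

/-- `1 / ∏_{α ∈ κ} α ^ n_α`; for `κ ⊆ Δ` the denominator is invertible in `R_Δ`. -/
def invMonomial (Δ κ : Finset V) (n : V → ℕ) : RDelta Δ :=
  Ring.inverse (∏ α ∈ κ, lin Δ α ^ n α)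

/-- `φ_κ = 1 / ∏_{α ∈ κ} α`. -/
def phi (Δ κ : Finset V) : RDelta Δ := Ring.inverse (∏ α ∈ κ, lin Δ α)

theorem evalR_phi {Δ κ : Finset V} (hκ : κ ⊆ Δ) (y : regDual Δ) :
    evalR y (phi Δ κ) = ∏ α ∈ κ, ((y : StrongDual ℝ V) α)⁻¹ := by
  have hu : IsUnit (∏ α ∈ κ, lin Δ α) := by
    rw [IsUnit.prod_iff]
    exact fun α hα => isUnit_lin (hκ hα)
  have h := congrArg (evalR y) (Ring.mul_inverse_cancel _ hu)
  rw [map_mul, map_prod, map_one] at h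
  simp only [evalR_lin] at h
  rw [Finset.prod_inv_distrib]
  exact eq_inv_of_mul_eq_one_right h

/-- `G_Δ`: the linear span of the `1 / ∏_{α ∈ κ} α ^ n_α` with `κ ⊆ Δ` generating `V` and all
`n_α` positive. -/
def GDelta (Δ : Finset V) : Submodule ℝ (RDelta Δ) :=
  Submodule.span ℝ {φ | ∃ (κ : Finset V) (n : V → ℕ), κ ⊆ Δ ∧
    Submodule.span ℝ (κ : Set V) = ⊤ ∧ (∀ α ∈ κ, 0 < n α) ∧ φ = invMonomial Δ κ n}

theorem deriv_prod_mem {Δ : Finset V} (z : StrongDual ℝ V) (κ τ : Finset V) (hτ : τ ⊆ κ)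
    (g : V → ℕ → RDelta Δ) (hg : ∀ α ∈ κ, ∀ n, ∃ c : ℝ, deriv Δ z (g α n) = c • g α (n + 1))
    (G : Submodule ℝ (RDelta Δ)) (n : V → ℕ) (hn : ∀ α ∈ κ, 0 < n α) (m : RDelta Δ)
    (hG : ∀ n' : V → ℕ, (∀ α ∈ κ, 0 < n' α) → (∀ α ∉ τ, n' α = n α) →
      m * ∏ α ∈ τ, g α (n' α) ∈ G) :
    m * deriv Δ z (∏ α ∈ τ, g α (n α)) ∈ G := by
  classical
  induction τ using Finset.induction_on generalizing m with
  | empty => simp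
  | insert a s has ih =>
    rw [Finset.prod_insert has, Derivation.leibniz, mul_add]
    have hsk : s ⊆ κ := fun x hx => hτ (Finset.mem_insert_of_mem hx)
    refine G.add_mem ?_ ?_
    · rw [smul_eq_mul, ← mul_assoc]
      refine ih hsk (m * g a (n a)) fun n' h1 h2 => ?_
      have := hG n' h1 (fun α hα => h2 α fun h => hα (Finset.mem_insert_of_mem h))
      rwa [Finset.prod_insert has, h2 a has, ← mul_assoc] at this
    · obtain ⟨c, hc⟩ := hg a (hτ (Finset.mem_insert_self a s)) (n a)
      have := hG (Function.update n a (n a + 1)) (fun α hα => by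
        by_cases h : α = a
        · subst h; simp
        · simpa [h] using hn α hα) (fun α hα => by
        have : α ≠ a := fun h => hα (h ▸ Finset.mem_insert_self a s)
        simp [this])
      rw [Finset.prod_insert has, Function.update_self, Finset.prod_congr rfl (fun α hα => by
        rw [Function.update_of_ne (show α ≠ a from fun h => has (h ▸ hα))])] at this
      rw [hc]
      have h2 := G.smul_mem c this
      convert h2 using 1
      simp only [smul_eq_mul, Algebra.smul_def]
      ring

theorem deriv_mem_GDelta (Δ : Finset V) (z : StrongDual ℝ V) {φ : RDelta Δ}
    (hφ : φ ∈ GDelta Δ) : deriv Δ z φ ∈ GDelta Δ := by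
  induction hφ using Submodule.span_induction with
  | zero => simp
  | add a b _ _ ha hb => rw [map_add]; exact Submodule.add_mem _ ha hb
  | smul c a _ ha => rw [Derivation.map_smul]; exact Submodule.smul_mem _ c ha
  | mem φ hφ =>
    obtain ⟨κ, n, hκ, hspan, hn, rfl⟩ := hφ
    have hu : ∀ α ∈ κ, ∀ k : ℕ, IsUnit (lin Δ α ^ k) := fun α hα k =>
      (isUnit_lin (hκ hα)).pow k
    have hinv : ∀ k : V → ℕ, invMonomial Δ κ k =
        ∏ α ∈ κ, Ring.inverse (lin Δ α) ^ k α := fun k => by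
      have h1 : (∏ α ∈ κ, lin Δ α ^ k α) * ∏ α ∈ κ, Ring.inverse (lin Δ α) ^ k α = 1 := by
        rw [← Finset.prod_mul_distrib]
        refine Finset.prod_eq_one fun α hα => ?_
        rw [← mul_pow, Ring.mul_inverse_cancel _ (isUnit_lin (hκ hα)), one_pow]
      have h2 : IsUnit (∏ α ∈ κ, lin Δ α ^ k α) := IsUnit.of_mul_eq_one _ h1
      exact h2.mul_left_cancel ((Ring.mul_inverse_cancel _ h2).trans h1.symm)
    have := deriv_prod_mem z κ κ subset_rfl (fun α k => Ring.inverse (lin Δ α) ^ k)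
      (fun α hα k => by
        refine ⟨-(k * z α), ?_⟩
        have h1 := (deriv Δ z).leibniz_of_mul_eq_one
          (Ring.inverse_mul_cancel _ (isUnit_lin (hκ hα)))
        rw [Derivation.leibniz_pow, h1, deriv_lin]
        rcases k with _ | k
        · simp
        · rw [nsmul_eq_mul]
          simp only [Nat.add_sub_cancel, smul_eq_mul, Algebra.smul_def, map_neg,
            map_mul, map_natCast]
          ring)
      (GDelta Δ) n hn 1 (fun n' h1 _ => by
        rw [one_mul, ← hinv]
        exact Submodule.subset_span ⟨κ, n', hκ, hspan, h1, rfl⟩)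
    rwa [one_mul, ← hinv] at this

theorem diffOp_mem_GDelta (Δ : Finset V) (P : SymmetricAlgebra ℝ (StrongDual ℝ V)) :
    ∀ φ ∈ GDelta Δ, diffOp Δ P φ ∈ GDelta Δ := by
  induction P using SymmetricAlgebra.induction with
  | algebraMap r =>
    intro φ hφ
    rw [AlgHom.commutes, Module.algebraMap_end_apply]
    exact Submodule.smul_mem _ r hφ
  | ι z =>
    intro φ hφ
    rw [diffOp_ι]
    exact deriv_mem_GDelta Δ z hφ
  | mul a b ha hb =>
    intro φ hφ
    rw [map_mul, Module.End.mul_apply]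
    exact ha _ (hb φ hφ)
  | add a b ha hb =>
    intro φ hφ
    rw [map_add, LinearMap.add_apply]
    exact Submodule.add_mem _ (ha φ hφ) (hb φ hφ)

/-- The action `P ↦ P(∂)` of `S(V*)` on `G_Δ`. -/
def diffG (Δ : Finset V) (P : SymmetricAlgebra ℝ (StrongDual ℝ V)) :
    GDelta Δ →ₗ[ℝ] GDelta Δ :=
  (diffOp Δ P).restrict (diffOp_mem_GDelta Δ P)

/-- The contraction `G_Δ ⊗ ∧^max V → G_Δ` with `dh ∈ ∧^max V*`, an element of `∧^r V*` being
viewed as an alternating `r`-form on `V` (so that `e¹ ∧ ⋯ ∧ eʳ` is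
`(v₁, …, v_r) ↦ det ⟨v_i, e^j⟩`). -/
def contract (Δ : Finset V) {r : ℕ} (dh : V [⋀^Fin r]→ₗ[ℝ] ℝ) :
    GDelta Δ ⊗[ℝ] (⋀[ℝ]^r V) →ₗ[ℝ] GDelta Δ :=
  (TensorProduct.rid ℝ (GDelta Δ)).toLinearMap ∘ₗ
    LinearMap.lTensor (GDelta Δ) (exteriorPower.alternatingMapLinearEquiv dh)

end Algebraic

/-! ## Locally polynomial functions -/

section Geometric

variable {V : Type*} [NormedAddCommGroup V] [NormedSpace ℝ V]

/-- `σ` is a basis of `Δ`: a subset of `Δ` which is a basis of `V`. -/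
structure IsBasisOf (Δ σ : Finset V) : Prop where
  subset : σ ⊆ Δ
  linearIndep : LinearIndepOn ℝ id (σ : Set V)
  span_eq_top : Submodule.span ℝ (σ : Set V) = ⊤

/-- A wall: a hyperplane of `V` generated by `dim V - 1` linearly independent elements of `Δ`. -/
def IsWall (Δ : Finset V) (W : Submodule ℝ V) : Prop :=
  ∃ s : Finset V, s ⊆ Δ ∧ LinearIndepOn ℝ id (s : Set V) ∧
    s.card + 1 = Module.finrank ℝ V ∧ W = Submodule.span ℝ (s : Set V)

/-- `V_{reg,Δ}`: the complement in `V` of the union of the walls. -/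
def regPrimal (Δ : Finset V) : Set V := {h | ∀ W, IsWall Δ W → h ∉ W}

/-- `P_Δ`: the functions on `V_{reg,Δ}` which are given by a polynomial function on each
connected component of `V_{reg,Δ}`. -/
def LocPoly (Δ : Finset V) : Submodule ℝ (regPrimal Δ → ℝ) where
  carrier := {F | ∀ x : regPrimal Δ, ∃ p : SymmetricAlgebra ℝ (StrongDual ℝ V),
    ∀ h ∈ connectedComponent x, F h = evalPrimal (h : V) p}
  zero_mem' := fun _ => ⟨0, fun _ _ => by simp⟩
  add_mem' := fun {F G} hF hG x => by
    obtain ⟨p, hp⟩ := hF x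
    obtain ⟨q, hq⟩ := hG x
    exact ⟨p + q, fun h hh => by simp [hp h hh, hq h hh]⟩
  smul_mem' := fun c F hF x => by
    obtain ⟨p, hp⟩ := hF x
    exact ⟨c • p, fun h hh => by simp [hp h hh]⟩

/-- `S(V*)` acts on `P_Δ` by multiplication. -/
def mulLocPoly (Δ : Finset V) (P : SymmetricAlgebra ℝ (StrongDual ℝ V)) :
    LocPoly Δ →ₗ[ℝ] LocPoly Δ where
  toFun F := ⟨fun h => evalPrimal (h : V) P * F.1 h, fun x => by
    obtain ⟨p, hp⟩ := F.2 x
    exact ⟨P * p, fun h hh => by simp [hp h hh]⟩⟩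
  map_add' F G := by ext h; simp [mul_add]
  map_smul' c F := by ext h; simp [mul_left_comm]

/-- `C(σ)`: the (closed) convex cone generated by the finite set `σ`. -/
def cone (σ : Finset V) : Set V := PointedCone.hull ℝ (σ : Set V)

theorem mem_cone_iff {σ : Finset V} (b : Basis σ ℝ V) (hb : ∀ i, b i = (i : V)) (h : V) :
    h ∈ cone σ ↔ ∀ i, 0 ≤ b.repr h i := by
  classical
  constructor
  · intro hh
    have hh' : h ∈ PointedCone.hull ℝ (σ : Set V) := hh
    induction hh' using Submodule.span_induction with
    | zero => simp
    | mem x hx =>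
      intro i
      have : x = b ⟨x, hx⟩ := (hb ⟨x, hx⟩).symm
      rw [this, Basis.repr_self, Finsupp.single_apply]
      split_ifs <;> norm_num
    | add x y hx hy h1 h2 =>
      intro i
      simpa using add_nonneg (h1 hx i) (h2 hy i)
    | smul c x hx h1 =>
      intro i
      have : c • x = (c : ℝ) • x := rfl
      rw [this, map_smul]
      exact mul_nonneg c.2 (h1 hx i)
  · intro hh
    rw [← b.sum_repr h]
    refine Submodule.sum_mem (PointedCone.hull ℝ (σ : Set V)) fun i _ => ?_
    have : b i ∈ PointedCone.hull ℝ (σ : Set V) := by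
      rw [hb]; exact PointedCone.subset_hull i.2
    exact PointedCone.smul_mem _ (hh i) this

theorem repr_ne_zero {Δ σ : Finset V} (hσ : IsBasisOf Δ σ) (b : Basis σ ℝ V)
    (hb : ∀ i, b i = (i : V)) {h : V} (hh : h ∈ regPrimal Δ) (i : σ) : b.repr h i ≠ 0 := by
  classical
  intro h0
  refine hh (Submodule.span ℝ ((σ.erase i : Finset V) : Set V)) ⟨σ.erase i,
    (Finset.erase_subset _ _).trans hσ.subset,
    hσ.linearIndep.mono (Finset.coe_subset.2 (Finset.erase_subset _ _)), ?_, rfl⟩ ?_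
  · rw [Finset.card_erase_add_one i.2, Module.finrank_eq_card_basis b, Fintype.card_coe]
  · rw [← b.sum_repr h]
    refine Submodule.sum_mem _ fun j _ => ?_
    by_cases hj : j = i
    · subst hj; simp [h0]
    · refine Submodule.smul_mem _ _ (Submodule.subset_span ?_)
      rw [hb]
      simpa using fun h => hj (Subtype.ext h)

open Classical in
/-- The function `f · [C(σ)]` on `V_{reg,Δ}`. -/
def polyConeFun (Δ : Finset V) (f : SymmetricAlgebra ℝ (StrongDual ℝ V)) (σ : Finset V) :
    regPrimal Δ → ℝ :=
  fun h => if (h : V) ∈ cone σ then evalPrimal (h : V) f else 0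

theorem polyConeFun_mem {Δ σ : Finset V} (hσ : IsBasisOf Δ σ)
    (f : SymmetricAlgebra ℝ (StrongDual ℝ V)) : polyConeFun Δ f σ ∈ LocPoly Δ := by
  let b : Basis σ ℝ V := Basis.mk (v := fun i : σ => (i : V)) hσ.linearIndep
    (by simpa using hσ.span_eq_top.ge)
  have hb : ∀ i, b i = (i : V) := fun i => Basis.mk_apply _ _ i
  have : FiniteDimensional ℝ V := b.finiteDimensional_of_finite
  have hcont : ∀ i, Continuous fun h : regPrimal Δ => b.repr (h : V) i := fun i =>
    (LinearMap.continuous_of_finiteDimensional (b.coord i)).comp continuous_subtype_val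
  have key : ∀ x y : regPrimal Δ, y ∈ connectedComponent x → (x : V) ∈ cone σ →
      (y : V) ∈ cone σ := by
    intro x y hy hx
    rw [mem_cone_iff b hb] at hx ⊢
    intro i
    by_contra hlt
    obtain ⟨w, -, hw⟩ := isPreconnected_connectedComponent.intermediate_value hy
      mem_connectedComponent (hcont i).continuousOn ⟨(not_le.1 hlt).le, hx i⟩
    exact repr_ne_zero hσ b hb w.2 i hw
  intro x
  by_cases hx : (x : V) ∈ cone σ
  · exact ⟨f, fun h hh => by simp [polyConeFun, key x h hh hx]⟩
  · refine ⟨0, fun h hh => ?_⟩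
    have : (h : V) ∉ cone σ := fun hc => hx (key h x (by
      rw [← connectedComponent_eq hh]; exact mem_connectedComponent) hc)
    simp [polyConeFun, this]

/-- The element `f · [C(σ)]` of `P_Δ`, for a basis `σ` of `Δ`. -/
def polyCone {Δ σ : Finset V} (hσ : IsBasisOf Δ σ)
    (f : SymmetricAlgebra ℝ (StrongDual ℝ V)) : LocPoly Δ :=
  ⟨polyConeFun Δ f σ, polyConeFun_mem hσ f⟩

/-- A chamber of `V*`: a connected component of `V*_{reg,Δ}`. -/
def IsChamber (Δ : Finset V) (δ : Set (StrongDual ℝ V)) : Prop :=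
  ∃ y ∈ regDual Δ, δ = connectedComponentIn (regDual Δ) y

/-- The closed dual cone `δ^∨ ⊆ V` of `δ ⊆ V*`. -/
def dualCone (δ : Set (StrongDual ℝ V)) : Set V := {h | ∀ y ∈ δ, 0 ≤ y h}

/-- `P_Δ(δ)`: the subspace of `P_Δ` spanned by the functions `f · [C(σ)]` with `f ∈ S(V*)` and
`σ` a basis of `Δ` such that `C(σ) ⊆ δ^∨`. -/
def ChamberLocPoly (Δ : Finset V) (δ : Set (StrongDual ℝ V)) : Submodule ℝ (LocPoly Δ) :=
  Submodule.span ℝ {F | ∃ (f : SymmetricAlgebra ℝ (StrongDual ℝ V)) (σ : Finset V)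
    (hσ : IsBasisOf Δ σ), cone σ ⊆ dualCone δ ∧ F = polyCone hσ f}

theorem mulLocPoly_mem (Δ : Finset V) (δ : Set (StrongDual ℝ V))
    (P : SymmetricAlgebra ℝ (StrongDual ℝ V)) :
    ∀ F ∈ ChamberLocPoly Δ δ, mulLocPoly Δ P F ∈ ChamberLocPoly Δ δ := by
  intro F hF
  induction hF using Submodule.span_induction with
  | zero => simp
  | add a b _ _ ha hb => rw [map_add]; exact Submodule.add_mem _ ha hb
  | smul c a _ ha => rw [map_smul]; exact Submodule.smul_mem _ c ha
  | mem F hF =>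
    obtain ⟨f, σ, hσ, hc, rfl⟩ := hF
    refine Submodule.subset_span ⟨P * f, σ, hσ, hc, ?_⟩
    ext h
    simp [mulLocPoly, polyCone, polyConeFun]

/-- `S(V*)` acts on `P_Δ(δ)` by multiplication. -/
def mulChamber (Δ : Finset V) (δ : Set (StrongDual ℝ V))
    (P : SymmetricAlgebra ℝ (StrongDual ℝ V)) : ChamberLocPoly Δ δ →ₗ[ℝ] ChamberLocPoly Δ δ :=
  (mulLocPoly Δ P).restrict (mulLocPoly_mem Δ δ P)

/-- The characteristic function `[C(σ)]` as an element of `P_Δ(δ)`. -/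
def coneIndicator {Δ σ : Finset V} {δ : Set (StrongDual ℝ V)} (hσ : IsBasisOf Δ σ)
    (hc : cone σ ⊆ dualCone δ) : ChamberLocPoly Δ δ :=
  ⟨polyCone hσ 1, Submodule.subset_span ⟨1, σ, hσ, hc, rfl⟩⟩

end Geometric

/-! ## The Laplace transform -/

section Laplace

variable {V : Type*} [NormedAddCommGroup V] [NormedSpace ℝ V] [FiniteDimensional ℝ V]
  [MeasurableSpace V] [BorelSpace V] {r : ℕ} [Fact (Module.finrank ℝ V = r)]

/-- `dh ∈ ∧^max V*` is positive with respect to the orientation `o`. -/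
def IsPositiveForm (o : Orientation ℝ V (Fin r)) (dh : V [⋀^Fin r]→ₗ[ℝ] ℝ) : Prop :=
  ∃ h : dh ≠ 0, rayOfNeZero ℝ dh h = o

open Classical in
/-- The integral `∫_{V,o} φ(h) dh` of a differential form of maximal degree over the oriented
space `V`: the integral of `φ` against the positive density `|dh|`, with a sign. -/
def orientedIntegral (o : Orientation ℝ V (Fin r)) (dh : V [⋀^Fin r]→ₗ[ℝ] ℝ) (φ : V → ℝ) : ℝ :=
  (if IsPositiveForm o dh then 1 else -1) * ∫ h, φ h ∂dh.measure

/-- `vol(σ, dh)`: the volume of the parallelepiped constructed on `σ`, for the density `|dh|`. -/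
def vol (σ : Finset V) (dh : V [⋀^Fin r]→ₗ[ℝ] ℝ) : ℝ :=
  dh.measure.real (parallelepiped (fun α : σ => (α : V)))

theorem vol_eq (σ : Finset V) (dh : V [⋀^Fin r]→ₗ[ℝ] ℝ) (e : Fin r ≃ σ) :
    vol σ dh = |dh (fun i => (e i : V))| := by
  have : parallelepiped (fun α : σ => (α : V)) = parallelepiped (fun i => (e i : V)) :=
    (parallelepiped_comp_equiv (fun α : σ => (α : V)) e).symm
  rw [vol, this, Measure.real, AlternatingMap.measure_parallelepiped,
    ENNReal.toReal_ofReal (abs_nonneg _)]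

open Classical in
/-- The integrand `h ↦ e^{-⟨y,h⟩} F(h)` of the Laplace transform of a function `F` on
`V_{reg,Δ}`; its values on the walls, a null set, are set to `0`. -/
def laplaceIntegrand {Δ : Finset V} (F : regPrimal Δ → ℝ) (y : StrongDual ℝ V) (h : V) : ℝ :=
  if hh : h ∈ regPrimal Δ then Real.exp (-(y h)) * F ⟨h, hh⟩ else 0

/-- `Φ ∈ G_Δ ⊗ ∧^max V` is the Laplace transform of `F ∈ P_Δ(δ)`: for all `dh ∈ ∧^max V*` and
all `y ∈ δ` the integral `∫_{V,o} e^{-⟨y,h⟩} F(h) dh` converges, and its value is the value at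
`y` of the rational function `⟨Φ, dh⟩`. -/
def IsLaplaceTransform {Δ : Finset V} {δ : Set (StrongDual ℝ V)} (o : Orientation ℝ V (Fin r))
    (F : ChamberLocPoly Δ δ) (Φ : GDelta Δ ⊗[ℝ] (⋀[ℝ]^r V)) : Prop :=
  ∀ (dh : V [⋀^Fin r]→ₗ[ℝ] ℝ) (y : regDual Δ), (y : StrongDual ℝ V) ∈ δ →
    Integrable (laplaceIntegrand F.1.1 (y : StrongDual ℝ V)) dh.measure ∧
    orientedIntegral o dh (laplaceIntegrand F.1.1 (y : StrongDual ℝ V)) =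
      evalR y (contract Δ dh Φ : RDelta Δ)

end Laplace

end HypArr

end

open HypArr MeasureTheory

open scoped TensorProduct

/-! In the coordinates of a basis σ that is positive at `y`, the cone C(σ) is an orthant, and
`e^{-⟨y,h⟩}` times a monomial is a product of one-variable functions. Fubini and `∫_0^∞ t^k e^{-at}
dt = k! a^{-k-1}` show that `f · [C(σ)]` has transform `vol(σ, dh) f(-∂) φ_σ` (`integral_cone`).
Since a rational function is determined by its values on the open set δ
(`eq_zero_of_evalR_eq_zero`), the transform is a well-defined linear map on the span of these
functions. Equivariance then needs no differentiation under the integral: on generators it is the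
multiplicativity of `P ↦ P(-∂)`.

Surjectivity is algebraic. Because Δ = -Δ, the denominators of an element of `G_Δ` may be taken
positive on δ. Partial fractions then reduce their support to bases
(`invMonomial_mem_span_isBasisOf`), and each inverse monomial on a basis σ is some `f(-∂) φ_σ`.

Injectivity is analytic. If the transform of `F` vanishes on δ, the positive and negative parts of
`e^{-y} F` are densities of finite measures whose moment generating functions agree near 0. Analytic
continuation to the imaginary axis identifies their characteristic functions, so `F = 0` almost
everywhere, hence everywhere by continuity on the regular set.

Finally, `∧^r V` is a line, so contraction with one positive form `dh₀` is an isomorphism, and the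
other forms are multiples of `dh₀`. -/

noncomputable section

namespace HypArr

open MeasureTheory Module TensorProduct

/-! ### Inverse monomials supported on a basis, as derivatives of `φ_σ` -/

section RationalFunctions

variable {V : Type*} [NormedAddCommGroup V] [NormedSpace ℝ V]

theorem invMonomial_eq_prod {Δ κ : Finset V} (hκ : κ ⊆ Δ) (n : V → ℕ) :
    invMonomial Δ κ n = ∏ α ∈ κ, Ring.inverse (lin Δ α) ^ n α := by
  have h1 : (∏ α ∈ κ, lin Δ α ^ n α) * ∏ α ∈ κ, Ring.inverse (lin Δ α) ^ n α = 1 := by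
    rw [← Finset.prod_mul_distrib]
    refine Finset.prod_eq_one fun α hα => ?_
    rw [← mul_pow, Ring.mul_inverse_cancel _ (isUnit_lin (hκ hα)), one_pow]
  have h2 : IsUnit (∏ α ∈ κ, lin Δ α ^ n α) := IsUnit.of_mul_eq_one _ h1
  exact h2.mul_left_cancel ((Ring.mul_inverse_cancel _ h2).trans h1.symm)

theorem phi_eq_invMonomial (Δ κ : Finset V) : phi Δ κ = invMonomial Δ κ fun _ => 1 := by
  simp [phi, invMonomial]

theorem evalR_inverse_lin {Δ : Finset V} (y : regDual Δ) {α : V} (hα : α ∈ Δ) :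
    evalR y (Ring.inverse (lin Δ α)) = ((y : StrongDual ℝ V) α)⁻¹ := by
  have h := congrArg (evalR y) (Ring.mul_inverse_cancel _ (isUnit_lin hα))
  rw [map_mul, evalR_lin, map_one] at h
  exact eq_inv_of_mul_eq_one_right h

theorem evalR_invMonomial {Δ κ : Finset V} (hκ : κ ⊆ Δ) (n : V → ℕ) (y : regDual Δ) :
    evalR y (invMonomial Δ κ n) = ∏ α ∈ κ, ((y : StrongDual ℝ V) α)⁻¹ ^ n α := by
  rw [invMonomial_eq_prod hκ, map_prod]
  refine Finset.prod_congr rfl fun α hα => ?_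
  rw [map_pow, evalR_inverse_lin y (hκ hα)]

theorem deriv_inverse_lin_pow {Δ : Finset V} (z : StrongDual ℝ V) {α : V} (hα : α ∈ Δ) (k : ℕ) :
    deriv Δ z (Ring.inverse (lin Δ α) ^ k) =
      (-(k * z α)) • Ring.inverse (lin Δ α) ^ (k + 1) := by
  have h1 := (deriv Δ z).leibniz_of_mul_eq_one (Ring.inverse_mul_cancel _ (isUnit_lin hα))
  rw [Derivation.leibniz_pow, h1, deriv_lin]
  rcases k with _ | k
  · simp
  · rw [nsmul_eq_mul]
    simp only [Nat.add_sub_cancel, smul_eq_mul, Algebra.smul_def, map_neg, map_mul, map_natCast]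
    ring

open Classical in
-- The direction `z` annihilates every factor except β, so a single term of the Leibniz rule
-- survives.
theorem deriv_invMonomial {Δ κ : Finset V} (hκ : κ ⊆ Δ) {z : StrongDual ℝ V} {β : V}
    (hβ : β ∈ κ) (hzβ : z β = 1) (hz : ∀ α ∈ κ, α ≠ β → z α = 0) (n : V → ℕ) :
    deriv Δ z (invMonomial Δ κ n) =
      (-(n β : ℝ)) • invMonomial Δ κ (Function.update n β (n β + 1)) := by
  have h0 : ∀ τ : Finset V, τ ⊆ κ.erase β →
      deriv Δ z (∏ α ∈ τ, Ring.inverse (lin Δ α) ^ n α) = 0 := by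
    intro τ hτ
    induction τ using Finset.induction_on with
    | empty => simp
    | insert a s has ih =>
      have ha := hτ (Finset.mem_insert_self a s)
      rw [Finset.mem_erase] at ha
      rw [Finset.prod_insert has, Derivation.leibniz,
        ih fun x hx => hτ (Finset.mem_insert_of_mem hx),
        deriv_inverse_lin_pow z (hκ ha.2), hz a ha.2 ha.1]
      simp
  rw [invMonomial_eq_prod hκ, invMonomial_eq_prod hκ, ← Finset.mul_prod_erase κ _ hβ,
    ← Finset.mul_prod_erase κ _ hβ, Derivation.leibniz, h0 _ subset_rfl,
    deriv_inverse_lin_pow z (hκ hβ), hzβ, Function.update_self]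
  have hcongr : ∀ α ∈ κ.erase β, Ring.inverse (lin Δ α) ^ Function.update n β (n β + 1) α =
      Ring.inverse (lin Δ α) ^ n α := fun α hα => by
    rw [Function.update_of_ne (Finset.ne_of_mem_erase hα)]
  rw [Finset.prod_congr rfl hcongr]
  simp only [mul_one, smul_eq_mul, Algebra.smul_def]
  ring

open Classical in
-- Each factor of the monomial acts as `-∂(z α)`, and its sign cancels that of `∂ α^{-k} = -k
-- α^{-k-1}`. The accumulated factors `k` give the same factorials as the Gamma integrals in
-- `integral_cone`.
theorem diffOp_negSubst_prod_phi {Δ σ : Finset V} (hσ : σ ⊆ Δ) {z : V → StrongDual ℝ V}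
    (hz : ∀ α ∈ σ, z α α = 1) (hz' : ∀ α ∈ σ, ∀ β ∈ σ, β ≠ α → z α β = 0) (s : Multiset V)
    (hs : ∀ α ∈ s, α ∈ σ) :
    diffOp Δ (negSubst (s.map fun α => SymmetricAlgebra.ι ℝ _ (z α)).prod) (phi Δ σ) =
      (∏ α ∈ σ, ((s.count α).factorial : ℝ)) • invMonomial Δ σ fun α => s.count α + 1 := by
  induction s using Multiset.induction_on with
  | empty => simp [phi_eq_invMonomial]
  | cons a s ih =>
    have ha : a ∈ σ := hs a (Multiset.mem_cons_self a s)
    have hcount : (fun α => (a ::ₘ s).count α + 1) =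
        Function.update (fun α => s.count α + 1) a (s.count a + 1 + 1) := by
      ext α
      by_cases h : α = a
      · subst h; simp
      · simp [h]
    have hfac : ∏ α ∈ σ, (((a ::ₘ s).count α).factorial : ℝ) =
        (s.count a + 1) * ∏ α ∈ σ, ((s.count α).factorial : ℝ) := by
      rw [← Finset.mul_prod_erase σ _ ha, ← Finset.mul_prod_erase σ _ ha,
        Finset.prod_congr rfl fun α hα => by
          rw [Multiset.count_cons_of_ne (Finset.ne_of_mem_erase hα)],
        Multiset.count_cons_self, Nat.factorial_succ]
      push_cast
      ring
    rw [Multiset.map_cons, Multiset.prod_cons, map_mul, map_mul, Module.End.mul_apply,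
      ih fun α hα => hs α (Multiset.mem_cons_of_mem hα), map_smul, negSubst,
      SymmetricAlgebra.lift_ι_apply, LinearMap.neg_apply, map_neg, LinearMap.neg_apply, diffOp_ι,
      deriv_invMonomial hσ ha (hz a ha) (hz' a ha), hcount, hfac, smul_neg, neg_smul, smul_neg,
      neg_neg, smul_smul]
    push_cast
    rw [mul_comm]

theorem span_multiset_prod_eq_top [FiniteDimensional ℝ V] {σ : Finset V}
    (z : V → StrongDual ℝ V) (hz : ∀ w : StrongDual ℝ V, w = ∑ α ∈ σ, w α • z α) :
    Submodule.span ℝ {f | ∃ s : Multiset V, (∀ α ∈ s, α ∈ σ) ∧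
      f = (s.map fun α => SymmetricAlgebra.ι ℝ (StrongDual ℝ V) (z α)).prod} = ⊤ := by
  rw [eq_top_iff]
  intro f _
  induction f using SymmetricAlgebra.induction with
  | algebraMap r =>
    rw [Algebra.algebraMap_eq_smul_one]
    exact Submodule.smul_mem _ _ (Submodule.subset_span ⟨0, by simp, by simp⟩)
  | ι w =>
    rw [hz w, map_sum]
    refine Submodule.sum_mem _ fun α hα => ?_
    rw [map_smul]
    exact Submodule.smul_mem _ _ (Submodule.subset_span ⟨{α}, by simpa using hα, by simp⟩)
  | add a b ha hb => exact Submodule.add_mem _ (ha trivial) (hb trivial)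
  | mul a b ha hb =>
    refine Submodule.span_induction₂ (p := fun a b _ _ => a * b ∈ _) ?_ ?_ ?_ ?_ ?_ ?_ ?_
      (ha trivial) (hb trivial)
    · rintro _ _ ⟨s, hs, rfl⟩ ⟨t, ht, rfl⟩
      refine Submodule.subset_span ⟨s + t, fun α hα => ?_, by simp⟩
      rcases Multiset.mem_add.1 hα with h | h
      exacts [hs α h, ht α h]
    · simp
    · simp
    · intro x y w _ _ _ h1 h2
      rw [add_mul]; exact Submodule.add_mem _ h1 h2
    · intro x y w _ _ _ h1 h2
      rw [mul_add]; exact Submodule.add_mem _ h1 h2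
    · intro c x y _ _ h
      rw [smul_mul_assoc]; exact Submodule.smul_mem _ c h
    · intro c x y _ _ h
      rw [mul_smul_comm]; exact Submodule.smul_mem _ c h

/-- A basis of `Δ` as a basis of `V` indexed by its elements. -/
def IsBasisOf.basis {Δ σ : Finset V} (hσ : IsBasisOf Δ σ) : Basis σ ℝ V :=
  Basis.mk (v := fun i : σ => (i : V)) hσ.linearIndep (by simpa using hσ.span_eq_top.ge)

@[simp]
theorem IsBasisOf.basis_apply {Δ σ : Finset V} (hσ : IsBasisOf Δ σ) (i : σ) :
    hσ.basis i = (i : V) :=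
  Basis.mk_apply _ _ i

theorem IsBasisOf.basis_repr_self {Δ σ : Finset V} (hσ : IsBasisOf Δ σ) {α : V} (hα : α ∈ σ) :
    hσ.basis.repr α = Finsupp.single ⟨α, hα⟩ 1 := by
  simpa using hσ.basis.repr_self ⟨α, hα⟩

open Classical in
/-- The coordinate function of `α` with respect to a basis `σ` of `Δ`, zero if `α ∉ σ`. -/
def IsBasisOf.dual [FiniteDimensional ℝ V] {Δ σ : Finset V} (hσ : IsBasisOf Δ σ) (α : V) :
    StrongDual ℝ V :=
  if h : α ∈ σ then LinearMap.toContinuousLinearMap (hσ.basis.coord ⟨α, h⟩) else 0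

theorem IsBasisOf.dual_coe_apply [FiniteDimensional ℝ V] {Δ σ : Finset V} (hσ : IsBasisOf Δ σ)
    (i : σ) (v : V) : hσ.dual i v = hσ.basis.repr v i := by
  simp [IsBasisOf.dual]

theorem IsBasisOf.dual_self [FiniteDimensional ℝ V] {Δ σ : Finset V} (hσ : IsBasisOf Δ σ)
    {α : V} (hα : α ∈ σ) : hσ.dual α α = 1 := by
  have := hσ.dual_coe_apply ⟨α, hα⟩ α
  rw [this, hσ.basis_repr_self hα]
  simp

theorem IsBasisOf.dual_of_ne [FiniteDimensional ℝ V] {Δ σ : Finset V} (hσ : IsBasisOf Δ σ)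
    {α β : V} (hα : α ∈ σ) (hβ : β ∈ σ) (h : β ≠ α) : hσ.dual α β = 0 := by
  have := hσ.dual_coe_apply ⟨α, hα⟩ β
  rw [this, hσ.basis_repr_self hβ]
  simp [h]

theorem IsBasisOf.eq_sum_dual [FiniteDimensional ℝ V] {Δ σ : Finset V} (hσ : IsBasisOf Δ σ)
    (w : StrongDual ℝ V) : w = ∑ α ∈ σ, w α • hσ.dual α := by
  ext v
  conv_lhs => rw [← hσ.basis.sum_repr v, map_sum]
  rw [← Finset.sum_coe_sort σ]
  simp [hσ.dual_coe_apply, mul_comm]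

/-- Reduces statements linear in `f` to monomials in the coordinates of σ, where both the integral
and the differential operator are explicit. -/
theorem IsBasisOf.induction_on [FiniteDimensional ℝ V] {Δ σ : Finset V} (hσ : IsBasisOf Δ σ)
    {p : SymmetricAlgebra ℝ (StrongDual ℝ V) → Prop}
    (monomial : ∀ s : Multiset V, (∀ α ∈ s, α ∈ σ) →
      p (s.map fun α => SymmetricAlgebra.ι ℝ _ (hσ.dual α)).prod)
    (zero : p 0) (add : ∀ f g, p f → p g → p (f + g)) (smul : ∀ (c : ℝ) f, p f → p (c • f))
    (f : SymmetricAlgebra ℝ (StrongDual ℝ V)) : p f := by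
  have hf : f ∈ Submodule.span ℝ {f | ∃ s : Multiset V, (∀ α ∈ s, α ∈ σ) ∧
      f = (s.map fun α => SymmetricAlgebra.ι ℝ (StrongDual ℝ V) (hσ.dual α)).prod} := by
    rw [span_multiset_prod_eq_top _ hσ.eq_sum_dual]; trivial
  induction hf using Submodule.span_induction with
  | zero => exact zero
  | add a b _ _ ha hb => exact add a b ha hb
  | smul c a _ ha => exact smul c a ha
  | mem f hf => obtain ⟨s, hs, rfl⟩ := hf; exact monomial s hs

theorem phi_mem_GDelta {Δ σ : Finset V} (hσ : IsBasisOf Δ σ) : phi Δ σ ∈ GDelta Δ :=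
  Submodule.subset_span ⟨σ, fun _ => 1, hσ.subset, hσ.span_eq_top, fun _ _ => one_pos,
    phi_eq_invMonomial Δ σ⟩

open Classical in
theorem exists_diffOp_phi_eq_invMonomial [FiniteDimensional ℝ V] {Δ σ : Finset V}
    (hσ : IsBasisOf Δ σ) (n : V → ℕ) (hn : ∀ α ∈ σ, 0 < n α) :
    ∃ f, diffOp Δ (negSubst f) (phi Δ σ) = invMonomial Δ σ n := by
  -- Differentiation takes the exponent 1 in `φ_σ` to multiplicity plus one, so multiplicity `n α -
  -- 1` is needed; positivity of `n α` makes the truncated subtraction exact.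
  set s : Multiset V := ∑ α ∈ σ, Multiset.replicate (n α - 1) α with hs_def
  have hs : ∀ α ∈ s, α ∈ σ := by
    intro α hα
    rw [hs_def, Multiset.mem_sum] at hα
    obtain ⟨β, hβ, h⟩ := hα
    rwa [Multiset.eq_of_mem_replicate h]
  have hc : ∀ α ∈ σ, s.count α = n α - 1 := by
    intro α hα
    rw [hs_def, Multiset.count_sum', Finset.sum_eq_single α]
    · simp
    · intro β _ h; simp [Multiset.count_replicate, h]
    · simp [hα]
  have h := diffOp_negSubst_prod_phi hσ.subset (fun α hα => hσ.dual_self hα)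
    (fun α hα β hβ h => hσ.dual_of_ne hα hβ h) s hs
  have hne : (∏ α ∈ σ, ((s.count α).factorial : ℝ)) ≠ 0 :=
    Finset.prod_ne_zero_iff.2 fun α _ => by positivity
  refine ⟨(∏ α ∈ σ, ((s.count α).factorial : ℝ))⁻¹ •
    (s.map fun α => SymmetricAlgebra.ι ℝ _ (hσ.dual α)).prod, ?_⟩
  rw [map_smul, map_smul, LinearMap.smul_apply, h, inv_smul_smul₀ hne,
    invMonomial_eq_prod hσ.subset, invMonomial_eq_prod hσ.subset]
  refine Finset.prod_congr rfl fun α hα => ?_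
  rw [hc α hα, Nat.sub_add_cancel (hn α hα)]

end RationalFunctions

/-! ### Partial fractions and reduction to bases positive at a point -/

section PartialFractions

variable {V : Type*} [NormedAddCommGroup V] [NormedSpace ℝ V]

open Classical in
theorem span_erase_eq_top {κ : Finset V} (hκ : Submodule.span ℝ (κ : Set V) = ⊤) {f : V → ℝ}
    (hf : ∑ α ∈ κ, f α • α = 0) {β : V} (hβ : β ∈ κ) (hfβ : f β ≠ 0) :
    Submodule.span ℝ ((κ.erase β : Finset V) : Set V) = ⊤ := by
  rw [eq_top_iff, ← hκ, Submodule.span_le]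
  intro α hα
  by_cases h : α = β
  · subst h
    rw [← Finset.add_sum_erase κ _ hβ, ← eq_neg_iff_add_eq_zero] at hf
    have : α = (f α)⁻¹ • -∑ x ∈ κ.erase α, f x • x := by rw [← hf, inv_smul_smul₀ hfβ]
    have hmem : (f α)⁻¹ • -∑ x ∈ κ.erase α, f x • x ∈
        Submodule.span ℝ ((κ.erase α : Finset V) : Set V) :=
      Submodule.smul_mem _ _ (Submodule.neg_mem _ (Submodule.sum_mem _ fun x hx =>
        Submodule.smul_mem _ _ (Submodule.subset_span hx)))
    rwa [← this] at hmem
  · exact Submodule.subset_span (Finset.mem_coe.2 (Finset.mem_erase.2 ⟨h, hα⟩))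

open Classical in
theorem invMonomial_erase {Δ κ : Finset V} (hκ : κ ⊆ Δ) {α : V} {n : V → ℕ} (hn : n α = 0) :
    invMonomial Δ κ n = invMonomial Δ (κ.erase α) n := by
  rw [invMonomial_eq_prod hκ, invMonomial_eq_prod ((Finset.erase_subset _ _).trans hκ),
    Finset.prod_erase _ (by rw [hn, pow_zero])]

open Classical in
theorem lin_mul_inverse_mul_invMonomial {Δ κ : Finset V} (hκ : κ ⊆ Δ) {α β : V} (hα : α ∈ κ)
    (hβ : β ∈ κ) (hne : α ≠ β) {n : V → ℕ} (hn : 0 < n α) :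
    lin Δ α * Ring.inverse (lin Δ β) * invMonomial Δ κ n =
      invMonomial Δ κ (Function.update (Function.update n β (n β + 1)) α (n α - 1)) := by
  have hβ' : β ∈ κ.erase α := Finset.mem_erase.2 ⟨hne.symm, hβ⟩
  rw [invMonomial_eq_prod hκ, invMonomial_eq_prod hκ, ← Finset.mul_prod_erase κ _ hα,
    ← Finset.mul_prod_erase κ _ hα, ← Finset.mul_prod_erase _ _ hβ',
    ← Finset.mul_prod_erase _ _ hβ', Function.update_self, Function.update_of_ne hne.symm,
    Function.update_self]
  have hcongr : ∀ x ∈ (κ.erase α).erase β, Ring.inverse (lin Δ x) ^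
      Function.update (Function.update n β (n β + 1)) α (n α - 1) x =
        Ring.inverse (lin Δ x) ^ n x := fun x hx => by
    simp only [Finset.mem_erase] at hx
    rw [Function.update_of_ne hx.2.1, Function.update_of_ne hx.1]
  rw [Finset.prod_congr rfl hcongr]
  obtain ⟨k, hk⟩ : ∃ k, n α = k + 1 := ⟨n α - 1, by omega⟩
  have hu := Ring.mul_inverse_cancel _ (isUnit_lin (hκ hα))
  rw [hk, Nat.add_sub_cancel]
  linear_combination (Ring.inverse (lin Δ α) ^ k * Ring.inverse (lin Δ β) ^ (n β + 1) *
    ∏ x ∈ (κ.erase α).erase β, Ring.inverse (lin Δ x) ^ n x) * hu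

open Classical in
-- Solving the relation for β gives `1 = ∑ -(f α / f β) α / β` over α ≠ β. Multiplying by this moves
-- one unit of exponent from α to β in each term, so the total exponent away from β decreases until
-- some factor disappears.
theorem invMonomial_mem_span_of_relation {Δ κ : Finset V} (hκ : κ ⊆ Δ) {f : V → ℝ}
    (hf : ∑ α ∈ κ, f α • α = 0) {β : V} (hβ : β ∈ κ) (hfβ : f β ≠ 0)
    (G : Submodule ℝ (RDelta Δ))
    (hG : ∀ α ∈ κ, f α ≠ 0 → ∀ n : V → ℕ, (∀ γ ∈ κ.erase α, 0 < n γ) →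
      invMonomial Δ (κ.erase α) n ∈ G) (N : ℕ) :
    ∀ n : V → ℕ, (∀ α ∈ κ, 0 < n α) → ∑ α ∈ κ.erase β, n α = N → invMonomial Δ κ n ∈ G := by
  induction N using Nat.strong_induction_on with
  | _ N ih =>
  intro n hn hN
  have hβu := Ring.mul_inverse_cancel _ (isUnit_lin (hκ hβ))
  have hrel : invMonomial Δ κ n = ∑ α ∈ κ.erase β,
      (-(f β)⁻¹ * f α) • (lin Δ α * Ring.inverse (lin Δ β) * invMonomial Δ κ n) := by
    have h1 := congrArg (lin Δ) hf
    rw [← Finset.add_sum_erase κ _ hβ, map_add, map_smul, map_sum, map_zero,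
      ← eq_neg_iff_add_eq_zero] at h1
    have h2 : lin Δ β = ∑ α ∈ κ.erase β, (-(f β)⁻¹ * f α) • lin Δ α := by
      rw [← inv_smul_smul₀ hfβ (lin Δ β), h1, smul_neg, Finset.smul_sum, ← Finset.sum_neg_distrib]
      refine Finset.sum_congr rfl fun α _ => ?_
      rw [map_smul, smul_smul, neg_mul, neg_smul]
    have h3 : ∑ α ∈ κ.erase β,
        (-(f β)⁻¹ * f α) • (lin Δ α * Ring.inverse (lin Δ β) * invMonomial Δ κ n) =
        (∑ α ∈ κ.erase β, (-(f β)⁻¹ * f α) • lin Δ α) *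
          (Ring.inverse (lin Δ β) * invMonomial Δ κ n) := by
      rw [Finset.sum_mul]
      refine Finset.sum_congr rfl fun α _ => ?_
      rw [smul_mul_assoc, mul_assoc]
    rw [h3, ← h2, ← mul_assoc, hβu, one_mul]
  rw [hrel]
  refine Submodule.sum_mem _ fun α hα => ?_
  by_cases hfα : f α = 0
  · simp [hfα]
  refine Submodule.smul_mem _ _ ?_
  obtain ⟨hne, hακ⟩ := Finset.mem_erase.1 hα
  rw [lin_mul_inverse_mul_invMonomial hκ hακ hβ hne (hn α hακ)]
  set m := Function.update (Function.update n β (n β + 1)) α (n α - 1) with hm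
  have hmα : m α = n α - 1 := by simp [hm]
  have hmpos : ∀ γ ∈ κ, γ ≠ α → 0 < m γ := by
    intro γ hγ h
    rw [hm, Function.update_of_ne h, Function.update_apply]
    split_ifs
    exacts [Nat.succ_pos _, hn γ hγ]
  -- If the exponent of α reaches 0, α leaves the denominator, and `f α ≠ 0` makes `hG` applicable;
  -- otherwise all exponents remain positive and the induction continues.
  by_cases h0 : n α - 1 = 0
  · rw [invMonomial_erase hκ (hmα.trans h0)]
    exact hG α hακ hfα m fun γ hγ => hmpos γ (Finset.mem_of_mem_erase hγ) (Finset.ne_of_mem_erase hγ)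
  · refine ih _ ?_ m (fun γ hγ => ?_) rfl
    · rw [← hN]
      refine Finset.sum_lt_sum (fun γ hγ => ?_) ⟨α, hα, by have := hn α hακ; omega⟩
      rw [hm, Function.update_apply, Function.update_of_ne (Finset.ne_of_mem_erase hγ)]
      split_ifs with h
      · subst h; omega
      · rfl
    · by_cases h : γ = α
      · subst h; omega
      · exact hmpos γ hγ h

/-- Partial fraction decomposition: the denominators can be taken to be supported on bases. -/
theorem invMonomial_mem_span_isBasisOf {Δ : Finset V} (κ : Finset V) (hκ : κ ⊆ Δ)
    (hspan : Submodule.span ℝ (κ : Set V) = ⊤) (n : V → ℕ) (hn : ∀ α ∈ κ, 0 < n α) :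
    invMonomial Δ κ n ∈ Submodule.span ℝ {φ | ∃ (σ : Finset V) (m : V → ℕ), σ ⊆ κ ∧
      IsBasisOf Δ σ ∧ (∀ α ∈ σ, 0 < m α) ∧ φ = invMonomial Δ σ m} := by
  classical
  induction κ using Finset.strongInduction generalizing n with
  | _ κ ih =>
  by_cases hli : LinearIndepOn ℝ id (κ : Set V)
  · exact Submodule.subset_span ⟨κ, n, subset_rfl, ⟨hκ, hli, hspan⟩, hn, rfl⟩
  · rw [linearIndepOn_finset_iff] at hli
    push Not at hli
    obtain ⟨f, hf, β, hβ, hfβ⟩ := hli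
    -- A vector with nonzero coefficient in the relation is a combination of the others, so the set
    -- without it still spans and the induction on κ applies.
    refine invMonomial_mem_span_of_relation hκ hf hβ hfβ _ (fun α hα hfα m hm => ?_) _ n hn rfl
    have hsub := (Finset.erase_subset α κ)
    refine Submodule.span_mono ?_ (ih (κ.erase α) (Finset.erase_ssubset hα) (hsub.trans hκ)
      (span_erase_eq_top hspan hf hα hfα) m hm)
    rintro φ ⟨σ, m', h1, h2⟩
    exact ⟨σ, m', h1.trans hsub, h2⟩

theorem inverse_lin_neg {Δ : Finset V} {α : V} (hα : α ∈ Δ) (hα' : -α ∈ Δ) :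
    Ring.inverse (lin Δ (-α)) = -Ring.inverse (lin Δ α) := by
  refine (isUnit_lin hα').mul_left_cancel ?_
  rw [Ring.mul_inverse_cancel _ (isUnit_lin hα'), map_neg, neg_mul_neg,
    Ring.mul_inverse_cancel _ (isUnit_lin hα)]

/-- The denominators can be taken to be positive at a given regular point of `V*`. -/
theorem exists_invMonomial_pos {Δ κ : Finset V} (h_symm : ∀ α ∈ Δ, -α ∈ Δ)
    {y : StrongDual ℝ V} (hy : y ∈ regDual Δ) (hκ : κ ⊆ Δ)
    (hspan : Submodule.span ℝ (κ : Set V) = ⊤) (n : V → ℕ) (hn : ∀ α ∈ κ, 0 < n α) :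
    ∃ (τ : Finset V) (m : V → ℕ) (c : ℝ), τ ⊆ Δ ∧ Submodule.span ℝ (τ : Set V) = ⊤ ∧
      (∀ α ∈ τ, 0 < m α) ∧ (∀ α ∈ τ, 0 < y α) ∧
      invMonomial Δ κ n = c • invMonomial Δ τ m := by
  classical
  set s : V → V := fun α => if 0 < y α then α else -α with hs
  have hsΔ : ∀ α ∈ κ, s α ∈ Δ := fun α hα => by
    simp only [hs]; split_ifs; exacts [hκ hα, h_symm α (hκ hα)]
  have hsub : κ.image s ⊆ Δ := Finset.image_subset_iff.2 hsΔ
  -- Both α and -α may lie in κ and acquire the same image, so exponents are added over the fibres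
  -- of `s`; the constant collects the signs.
  refine ⟨κ.image s, fun β => ∑ α ∈ κ with s α = β, n α,
    ∏ α ∈ κ, (if 0 < y α then 1 else (-1) ^ n α), hsub, ?_, ?_, ?_, ?_⟩
  · rw [eq_top_iff, ← hspan, Submodule.span_le]
    intro α hα
    have h : s α ∈ Submodule.span ℝ ((κ.image s : Finset V) : Set V) :=
      Submodule.subset_span (Finset.mem_coe.2 (Finset.mem_image_of_mem s hα))
    simp only [hs] at h
    split_ifs at h
    · exact h
    · simpa using h
  · intro β hβ
    obtain ⟨α, hα, rfl⟩ := Finset.mem_image.1 hβ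
    exact Finset.sum_pos' (fun _ _ => Nat.zero_le _) ⟨α, by simpa using hα, hn α hα⟩
  · intro β hβ
    obtain ⟨α, hα, rfl⟩ := Finset.mem_image.1 hβ
    simp only [hs]
    split_ifs with h
    · exact h
    · rw [map_neg]
      exact neg_pos.2 (lt_of_le_of_ne (not_lt.1 h) (hy α (hκ hα)))
  · rw [invMonomial_eq_prod hκ, invMonomial_eq_prod hsub, Algebra.smul_def, map_prod]
    have h1 : ∏ β ∈ κ.image s, Ring.inverse (lin Δ β) ^ (∑ α ∈ κ with s α = β, n α) =
        ∏ α ∈ κ, Ring.inverse (lin Δ (s α)) ^ n α := by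
      rw [← Finset.prod_fiberwise_of_maps_to (s := κ)
        (fun α hα => Finset.mem_image_of_mem s hα) (fun α => Ring.inverse (lin Δ (s α)) ^ n α)]
      refine Finset.prod_congr rfl fun β _ => ?_
      rw [← Finset.prod_pow_eq_pow_sum]
      refine Finset.prod_congr rfl fun α hα => ?_
      rw [(Finset.mem_filter.1 hα).2]
    rw [h1, ← Finset.prod_mul_distrib]
    refine Finset.prod_congr rfl fun α hα => ?_
    simp only [hs]
    split_ifs
    · simp
    · rw [inverse_lin_neg (hκ hα) (h_symm α (hκ hα)), map_pow, ← mul_pow]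
      simp

/-- Signs are adjusted before partial fractions are taken: the latter only select subsets of the
denominators, so positivity at `y` is inherited by every basis that occurs. -/
theorem GDelta_le_span_diffOp_phi [FiniteDimensional ℝ V] {Δ : Finset V}
    (h_symm : ∀ α ∈ Δ, -α ∈ Δ) {y : StrongDual ℝ V} (hy : y ∈ regDual Δ) :
    GDelta Δ ≤ Submodule.span ℝ {φ | ∃ (f : SymmetricAlgebra ℝ (StrongDual ℝ V)) (σ : Finset V),
      IsBasisOf Δ σ ∧ (∀ α ∈ σ, 0 < y α) ∧ φ = diffOp Δ (negSubst f) (phi Δ σ)} := by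
  refine Submodule.span_le.2 ?_
  rintro _ ⟨κ, n, hκ, hspan, hn, rfl⟩
  obtain ⟨τ, m, c, hτ, hspan', hm, hpos, h⟩ := exists_invMonomial_pos h_symm hy hκ hspan n hn
  rw [SetLike.mem_coe, h]
  refine Submodule.smul_mem _ c (Submodule.span_mono ?_
    (invMonomial_mem_span_isBasisOf τ hτ hspan' m hm))
  rintro _ ⟨σ, k, hσ, hb, hk, rfl⟩
  obtain ⟨f, hf⟩ := exists_diffOp_phi_eq_invMonomial hb k hk
  exact ⟨f, σ, hb, fun α hα => hpos α (hσ hα), hf.symm⟩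

end PartialFractions

/-! ### Rational functions are determined by their values on an open set -/

section Evaluation

variable {V : Type*} [NormedAddCommGroup V] [NormedSpace ℝ V] [FiniteDimensional ℝ V]

theorem eq_zero_of_evalDual_eq_zero {U : Set (StrongDual ℝ V)} (hU : IsOpen U)
    (hne : U.Nonempty) {s : SymmetricAlgebra ℝ V} (hs : ∀ y ∈ U, evalDual y s = 0) : s = 0 := by
  let b := finBasis ℝ V
  let T : (Fin (finrank ℝ V) → ℝ) →ₗ[ℝ] StrongDual ℝ V :=
    (LinearMap.toContinuousLinearMap.toLinearMap : (V →ₗ[ℝ] ℝ) →ₗ[ℝ] (V →L[ℝ] ℝ)) ∘ₗ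
      (b.constr ℝ).toLinearMap
  have hTb : ∀ x i, T x (b i) = x i := fun x i => by simp [T]
  have hTc : Continuous T := T.continuous_of_finiteDimensional
  obtain ⟨y₀, hy₀⟩ := hne
  have hTy : T (fun i => y₀ (b i)) = y₀ := by
    have : (T (fun i => y₀ (b i)) : V →ₗ[ℝ] ℝ) = (y₀ : V →ₗ[ℝ] ℝ) :=
      b.ext fun i => by simpa using hTb _ i
    ext v
    exact congrArg (fun g => g v) this
  obtain ⟨ε, hε, hball⟩ := Metric.isOpen_iff.1 (hU.preimage hTc) (fun i => y₀ (b i))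
    (by simpa [hTy] using hy₀)
  have heval : ∀ x, evalDual (T x) s =
      MvPolynomial.eval x (SymmetricAlgebra.equivMvPolynomial b s) := by
    intro x
    have : evalDual (T x) = (MvPolynomial.aeval x).comp
        (SymmetricAlgebra.equivMvPolynomial b).toAlgHom := by
      apply SymmetricAlgebra.algHom_ext
      refine b.ext fun i => ?_
      simp [evalDual, hTb]
    rw [this]
    simp [MvPolynomial.aeval_eq_eval]
  have h0 : SymmetricAlgebra.equivMvPolynomial b s = 0 := by
    -- A ball for the sup norm is a product of intervals, and a polynomial vanishing on a product of
    -- infinite sets is zero.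
    refine MvPolynomial.funext_set (fun i => Metric.ball (y₀ (b i)) ε) (fun i => ?_)
      fun x hx => ?_
    · rw [Real.ball_eq_Ioo]
      exact Set.Ioo_infinite (by linarith)
    · rw [← heval, map_zero]
      refine hs _ (hball ?_)
      rwa [ball_pi _ hε]
  simpa using h0

theorem eq_zero_of_evalR_eq_zero {Δ : Finset V} {U : Set (StrongDual ℝ V)} (hU : IsOpen U)
    (hne : U.Nonempty) (hreg : U ⊆ regDual Δ) {φ : RDelta Δ}
    (hφ : ∀ y : regDual Δ, (y : StrongDual ℝ V) ∈ U → evalR y φ = 0) : φ = 0 := by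
  obtain ⟨⟨s, d⟩, hsd⟩ := IsLocalization.surj (denominators Δ) φ
  have hs : s = 0 := by
    refine eq_zero_of_evalDual_eq_zero hU hne fun y hy => ?_
    have h := congrArg (evalR ⟨y, hreg hy⟩) hsd
    rw [map_mul, hφ _ hy, zero_mul] at h
    simpa [evalR] using h.symm
  rw [hs, map_zero] at hsd
  exact (IsLocalization.map_units (RDelta Δ) d).mul_left_eq_zero.1 hsd

end Evaluation

/-! ### The integrand in the coordinates of a basis -/

section Coordinates

variable {V : Type*} [NormedAddCommGroup V] [NormedSpace ℝ V]

theorem evalPrimal_ι (h : V) (z : StrongDual ℝ V) :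
    evalPrimal h (SymmetricAlgebra.ι ℝ (StrongDual ℝ V) z) = z h := by
  simp [evalPrimal]

theorem IsBasisOf.apply_eq_sum {Δ σ : Finset V} (hσ : IsBasisOf Δ σ) (y : StrongDual ℝ V)
    (h : V) : y h = ∑ i : σ, y (i : V) * hσ.basis.equivFunL h i := by
  conv_lhs => rw [← hσ.basis.sum_repr h, map_sum]
  simp [Basis.equivFunL, mul_comm]

variable [FiniteDimensional ℝ V]

open Classical in
theorem IsBasisOf.evalPrimal_prod {Δ σ : Finset V} (hσ : IsBasisOf Δ σ) (s : Multiset V)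
    (hs : ∀ α ∈ s, α ∈ σ) (h : V) :
    evalPrimal h (s.map fun α => SymmetricAlgebra.ι ℝ _ (hσ.dual α)).prod =
      ∏ i : σ, hσ.basis.equivFunL h i ^ s.count (i : V) := by
  rw [map_multiset_prod, Multiset.map_map, Finset.prod_multiset_map_count,
    Finset.prod_subset (s₂ := σ) (fun α hα => hs α (Multiset.mem_toFinset.1 hα))
      (fun α _ hα => by
        rw [Multiset.count_eq_zero_of_notMem (by simpa using hα), pow_zero]),
    ← Finset.prod_coe_sort σ]
  refine Finset.prod_congr rfl fun i _ => ?_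
  rw [Function.comp_apply, evalPrimal_ι, hσ.dual_coe_apply]
  rfl

open Classical in
-- The cone is the nonnegative orthant, and the exponential of a sum and the monomial both factor;
-- this is the form required by Fubini.
theorem IsBasisOf.indicator_cone_eq_prod {Δ σ : Finset V} (hσ : IsBasisOf Δ σ) (s : Multiset V)
    (hs : ∀ α ∈ s, α ∈ σ) (y : StrongDual ℝ V) :
    ((cone σ).indicator fun h => Real.exp (-(y h)) *
      evalPrimal h (s.map fun α => SymmetricAlgebra.ι ℝ _ (hσ.dual α)).prod) =
      (fun x : σ → ℝ => ∏ i : σ, (Set.Ici (0 : ℝ)).indicator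
        (fun t => t ^ s.count (i : V) * Real.exp (-(y (i : V) * t))) (x i)) ∘
          hσ.basis.equivFunL := by
  ext h
  rw [Function.comp_apply]
  by_cases hc : h ∈ cone σ
  · have hc' := (mem_cone_iff hσ.basis hσ.basis_apply h).1 hc
    rw [Set.indicator_of_mem hc, hσ.evalPrimal_prod s hs, hσ.apply_eq_sum y h,
      ← Finset.sum_neg_distrib, Real.exp_sum, ← Finset.prod_mul_distrib]
    refine Finset.prod_congr rfl fun i _ => ?_
    rw [Set.indicator_of_mem (show hσ.basis.equivFunL h i ∈ Set.Ici (0 : ℝ) from hc' i), mul_comm]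
  · rw [Set.indicator_of_notMem hc]
    rw [mem_cone_iff hσ.basis hσ.basis_apply] at hc
    push Not at hc
    obtain ⟨i, hi⟩ := hc
    refine (Finset.prod_eq_zero (Finset.mem_univ i) (Set.indicator_of_notMem ?_ _)).symm
    exact fun h0 => absurd h0 (not_le.2 hi)

end Coordinates

/-! ### The Laplace integral over a simplicial cone -/

section ConeIntegral

theorem integrable_indicator_pow_mul_exp (k : ℕ) {a : ℝ} (ha : 0 < a) :
    Integrable ((Set.Ici (0 : ℝ)).indicator fun t => t ^ k * Real.exp (-(a * t))) := by
  rw [integrable_indicator_iff measurableSet_Ici, integrableOn_Ici_iff_integrableOn_Ioi]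
  have h := integrableOn_rpow_mul_exp_neg_mul_rpow (s := k) (p := 1) (b := a)
    (by have : (0 : ℝ) ≤ k := k.cast_nonneg
        linarith) one_pos ha
  simpa using h

theorem integral_indicator_pow_mul_exp (k : ℕ) {a : ℝ} (ha : 0 < a) :
    ∫ t, (Set.Ici (0 : ℝ)).indicator (fun t => t ^ k * Real.exp (-(a * t))) t =
      (k.factorial : ℝ) * a⁻¹ ^ (k + 1) := by
  rw [integral_indicator measurableSet_Ici, integral_Ici_eq_integral_Ioi]
  have h := Real.integral_rpow_mul_exp_neg_mul_Ioi (a := k + 1) (r := a) (by positivity) ha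
  rw [Real.Gamma_nat_eq_factorial] at h
  simp only [add_sub_cancel_right, Real.rpow_natCast, one_div] at h
  rw [h, mul_comm]
  norm_cast

variable {V : Type*} [NormedAddCommGroup V] [NormedSpace ℝ V] [MeasurableSpace V] [BorelSpace V]

/-- Coordinates carry `b` to the standard basis, and both measures are the Haar measure giving mass
1 to the parallelepiped of the basis. -/
theorem volume_pi_eq_map_addHaar {ι : Type*} [Fintype ι] (b : Basis ι ℝ V) :
    b.addHaar.map b.equivFunL = volume := by
  classical
  have h : b.map (b.equivFunL : V ≃ₗ[ℝ] ι → ℝ) = Pi.basisFun ℝ ι := by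
    refine Basis.eq_of_apply_eq fun i => ?_
    ext j
    rw [Pi.basisFun_apply, Basis.map_apply]
    change b.repr (b i) j = _
    rw [b.repr_self, Finsupp.single_apply, Pi.single_apply]
    simp only [eq_comm]
  rw [Basis.map_addHaar, h, ← addHaarMeasure_eq_volume_pi, ← Basis.parallelepiped_basisFun,
    ← Basis.addHaar_def]

variable [FiniteDimensional ℝ V] {r : ℕ} [Fact (Module.finrank ℝ V = r)]

/-- Invariant measures are proportional, and evaluation on the parallelepiped of σ, which has Haar
mass 1, identifies the factor. The case `dh = 0` is included. -/
theorem measure_eq_smul_addHaar {Δ σ : Finset V} (hσ : IsBasisOf Δ σ)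
    (dh : V [⋀^Fin r]→ₗ[ℝ] ℝ) :
    dh.measure = ENNReal.ofReal (vol σ dh) • hσ.basis.addHaar := by
  have h := Measure.isAddLeftInvariant_eq_smul dh.measure hσ.basis.addHaar
  have hp : parallelepiped (fun α : σ => (α : V)) = parallelepiped hσ.basis := by
    congr 1; ext i; simp
  have hvol : vol σ dh = dh.measure.addHaarScalarFactor hσ.basis.addHaar := by
    have h' := congrArg (fun μ : Measure V => μ.real (parallelepiped hσ.basis)) h
    rw [vol, hp]
    refine h'.trans ?_
    simp only [Measure.real, Measure.smul_apply, Basis.addHaar_self]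
    simp
  rw [hvol]
  conv_lhs => rw [h]
  rw [ENNReal.ofReal_coe_nnreal]
  rfl

theorem vol_nonneg (σ : Finset V) (dh : V [⋀^Fin r]→ₗ[ℝ] ℝ) : 0 ≤ vol σ dh :=
  measureReal_nonneg

/-- The Laplace transform of the function `f · [C(σ)]`, with respect to the density `|dh|`. -/
theorem integral_cone {Δ σ : Finset V} (hσ : IsBasisOf Δ σ) (dh : V [⋀^Fin r]→ₗ[ℝ] ℝ)
    (y : regDual Δ) (hpos : ∀ α ∈ σ, 0 < (y : StrongDual ℝ V) α)
    (f : SymmetricAlgebra ℝ (StrongDual ℝ V)) :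
    Integrable ((cone σ).indicator fun h =>
        Real.exp (-((y : StrongDual ℝ V) h)) * evalPrimal h f) dh.measure ∧
      ∫ h, (cone σ).indicator (fun h =>
        Real.exp (-((y : StrongDual ℝ V) h)) * evalPrimal h f) h ∂dh.measure =
        vol σ dh * evalR y (diffOp Δ (negSubst f) (phi Δ σ)) := by
  classical
  induction f using hσ.induction_on with
  | zero => simp
  | add f g hf hg =>
    simp only [map_add, mul_add, LinearMap.add_apply]
    have h : ((cone σ).indicator fun h : V => Real.exp (-((y : StrongDual ℝ V) h)) *
        evalPrimal h f + Real.exp (-((y : StrongDual ℝ V) h)) * evalPrimal h g) =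
      (cone σ).indicator (fun h => Real.exp (-((y : StrongDual ℝ V) h)) * evalPrimal h f) +
      (cone σ).indicator (fun h => Real.exp (-((y : StrongDual ℝ V) h)) * evalPrimal h g) :=
      Set.indicator_add' _ _ _
    rw [h]
    exact ⟨hf.1.add hg.1, by rw [integral_add' hf.1 hg.1, hf.2, hg.2]⟩
  | smul c f hf =>
    simp only [map_smul, mul_smul_comm, LinearMap.smul_apply]
    have h : ((cone σ).indicator fun h : V => c • (Real.exp (-((y : StrongDual ℝ V) h)) *
        evalPrimal h f)) =
      c • (cone σ).indicator (fun h => Real.exp (-((y : StrongDual ℝ V) h)) * evalPrimal h f) :=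
      Set.indicator_const_smul _ _ _
    rw [h]
    refine ⟨hf.1.smul c, ?_⟩
    simp only [Pi.smul_apply]
    rw [integral_smul, hf.2]
  | monomial s hs =>
    rw [hσ.indicator_cone_eq_prod s hs, measure_eq_smul_addHaar hσ dh, integral_smul_measure,
      ENNReal.toReal_ofReal (vol_nonneg _ _)]
    have hmp : MeasurePreserving hσ.basis.equivFunL hσ.basis.addHaar volume :=
      ⟨hσ.basis.equivFunL.continuous.measurable, volume_pi_eq_map_addHaar _⟩
    have hemb : MeasurableEmbedding hσ.basis.equivFunL :=
      hσ.basis.equivFunL.toHomeomorph.measurableEmbedding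
    constructor
    · refine Integrable.smul_measure ?_ ENNReal.ofReal_ne_top
      rw [hmp.integrable_comp_emb hemb]
      exact Integrable.fintype_prod fun i =>
        integrable_indicator_pow_mul_exp (s.count (i : V)) (hpos i i.2)
    · rw [smul_eq_mul]
      congr 1
      have h1 := hmp.integral_comp hemb fun x : σ → ℝ => ∏ i : σ, (Set.Ici (0 : ℝ)).indicator
        (fun t => t ^ s.count (i : V) * Real.exp (-((y : StrongDual ℝ V) (i : V) * t))) (x i)
      simp only [Function.comp_apply]
      rw [h1, integral_fintype_prod_volume_eq_prod fun (i : σ) => (Set.Ici (0 : ℝ)).indicator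
        (fun t => t ^ s.count (i : V) * Real.exp (-((y : StrongDual ℝ V) (i : V) * t))),
        diffOp_negSubst_prod_phi hσ.subset (fun α hα => hσ.dual_self hα)
          (fun α hα β hβ h => hσ.dual_of_ne hα hβ h) s hs, map_smul,
        evalR_invMonomial hσ.subset, smul_eq_mul, ← Finset.prod_mul_distrib,
        ← Finset.prod_coe_sort σ]
      exact Finset.prod_congr rfl fun i _ => integral_indicator_pow_mul_exp _ (hpos i i.2)

end ConeIntegral

/-! ### Chambers and constancy of signs -/

section Chambers

variable {V : Type*} [NormedAddCommGroup V] [NormedSpace ℝ V]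

theorem isOpen_regDual (Δ : Finset V) : IsOpen (regDual Δ) := by
  have : regDual Δ = ⋂ α ∈ Δ, {y : StrongDual ℝ V | y α ≠ 0} := by
    ext y; simp [regDual]
  rw [this]
  exact isOpen_biInter_finset fun α _ =>
    isOpen_ne_fun (ContinuousLinearMap.apply ℝ ℝ α).continuous continuous_const

namespace IsChamber

variable {Δ : Finset V} {δ : Set (StrongDual ℝ V)}

theorem isOpen (hδ : IsChamber Δ δ) : IsOpen δ := by
  obtain ⟨y, hy, rfl⟩ := hδ
  exact (isOpen_regDual Δ).connectedComponentIn

theorem nonempty (hδ : IsChamber Δ δ) : δ.Nonempty := by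
  obtain ⟨y, hy, rfl⟩ := hδ
  exact ⟨y, mem_connectedComponentIn hy⟩

theorem subset (hδ : IsChamber Δ δ) : δ ⊆ regDual Δ := by
  obtain ⟨y, hy, rfl⟩ := hδ
  exact connectedComponentIn_subset _ _

/-- δ is connected and α has no zero on it, so the intermediate value theorem forbids a change of
sign. Hence positivity of σ at a single point of δ already forces `C(σ) ⊆ δ^∨`. -/
theorem pos_of_pos (hδ : IsChamber Δ δ) {α : V} (hα : α ∈ Δ) {y y' : StrongDual ℝ V}
    (hy : y ∈ δ) (hy' : y' ∈ δ) (h : 0 < y α) : 0 < y' α := by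
  by_contra hneg
  have hconn : IsPreconnected δ := by
    obtain ⟨y, -, rfl⟩ := hδ
    exact isPreconnected_connectedComponentIn
  obtain ⟨w, hw, hw0⟩ := hconn.intermediate_value hy' hy
    (ContinuousLinearMap.apply ℝ ℝ α).continuous.continuousOn ⟨not_lt.1 hneg, h.le⟩
  exact hδ.subset hw α hα hw0

theorem pos_of_cone_subset (hδ : IsChamber Δ δ) {σ : Finset V} (hσ : σ ⊆ Δ)
    (hc : cone σ ⊆ dualCone δ) {y : StrongDual ℝ V} (hy : y ∈ δ) {α : V} (hα : α ∈ σ) :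
    0 < y α :=
  lt_of_le_of_ne (hc (PointedCone.subset_hull hα) y hy) (hδ.subset hy α (hσ hα)).symm

theorem cone_subset_of_pos (hδ : IsChamber Δ δ) {σ : Finset V} (hσ : σ ⊆ Δ)
    {y : StrongDual ℝ V} (hy : y ∈ δ) (hpos : ∀ α ∈ σ, 0 < y α) : cone σ ⊆ dualCone δ := by
  intro h hh y' hy'
  have hh' : h ∈ PointedCone.hull ℝ (σ : Set V) := hh
  induction hh' using Submodule.span_induction with
  | zero => simp
  | mem α hα => exact (hδ.pos_of_pos (hσ hα) hy hy' (hpos α hα)).le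
  | add a b ha hb h1 h2 => rw [map_add]; exact add_nonneg (h1 ha) (h2 hb)
  | smul c a ha h1 =>
    rw [show c • a = (c : ℝ) • a from rfl, map_smul]
    exact mul_nonneg c.2 (h1 ha)

end IsChamber

end Chambers

/-! ### Walls are null, and locally polynomial functions are continuous -/

section Walls

variable {V : Type*} [NormedAddCommGroup V] [NormedSpace ℝ V]

theorem finite_setOf_isWall (Δ : Finset V) : {W | IsWall Δ W}.Finite := by
  refine (Δ.powerset.finite_toSet.image fun s : Finset V => Submodule.span ℝ (s : Set V)).subset ?_
  rintro _ ⟨s, hs, -, -, rfl⟩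
  exact ⟨s, by simpa using hs, rfl⟩

theorem compl_regPrimal (Δ : Finset V) :
    (regPrimal Δ)ᶜ = ⋃ W ∈ {W | IsWall Δ W}, (W : Set V) := by
  ext h
  simp [regPrimal]

theorem IsWall.ne_top {Δ : Finset V} {W : Submodule ℝ V} (hW : IsWall Δ W) : W ≠ ⊤ := by
  obtain ⟨s, -, hs, hcard, rfl⟩ := hW
  intro h
  have h1 := finrank_span_finset_eq_card hs
  rw [h, finrank_top] at h1
  omega

theorem continuous_evalPrimal (p : SymmetricAlgebra ℝ (StrongDual ℝ V)) :
    Continuous fun h : V => evalPrimal h p := by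
  induction p using SymmetricAlgebra.induction with
  | algebraMap r => simpa using continuous_const
  | ι z => simpa [evalPrimal] using z.continuous
  | mul a b ha hb => simp only [map_mul]; exact ha.mul hb
  | add a b ha hb => simp only [map_add]; exact ha.add hb

variable [FiniteDimensional ℝ V]

theorem isOpen_regPrimal (Δ : Finset V) : IsOpen (regPrimal Δ) := by
  rw [← isClosed_compl_iff, compl_regPrimal]
  exact (finite_setOf_isWall Δ).isClosed_biUnion fun W _ => W.closed_of_finiteDimensional

/-- The regular set is open in a locally connected space, so its components are open and `F` agrees
with a polynomial near each point. This later upgrades vanishing almost everywhere to vanishing. -/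
theorem LocPoly.continuous {Δ : Finset V} (F : LocPoly Δ) : Continuous F.1 := by
  have : LocallyConnectedSpace V := inferInstance
  have : LocallyConnectedSpace (regPrimal Δ) := (isOpen_regPrimal Δ).locallyConnectedSpace
  rw [continuous_iff_continuousAt]
  intro x
  obtain ⟨p, hp⟩ := F.2 x
  have hc : ContinuousAt (fun h : regPrimal Δ => evalPrimal (h : V) p) x :=
    ((continuous_evalPrimal p).comp continuous_subtype_val).continuousAt
  refine hc.congr ?_
  filter_upwards [isOpen_connectedComponent.mem_nhds (mem_connectedComponent (x := x))] with h hh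
  exact (hp h hh).symm

variable [MeasurableSpace V] [BorelSpace V]

theorem measure_compl_regPrimal (Δ : Finset V) (μ : Measure V) [μ.IsAddHaarMeasure] :
    μ (regPrimal Δ)ᶜ = 0 := by
  rw [compl_regPrimal, measure_biUnion_null_iff (finite_setOf_isWall Δ).countable]
  exact fun W hW => Measure.addHaar_submodule μ W (IsWall.ne_top hW)

end Walls

/-! ### Injectivity of the Laplace transform by analytic continuation -/

section LaplaceUniqueness

open ProbabilityTheory Filter Topology

/-- Both complex generating functions are analytic on the strip `|Re z| < ε`, which contains `I`.
They agree on a real interval around 0, so the identity theorem applies. -/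
theorem complexMGF_I_eq_of_mgf_eq {Ω : Type*} [MeasurableSpace Ω] {μ ν : Measure Ω} {X : Ω → ℝ}
    {ε : ℝ} (hε : 0 < ε) (hμ : Set.Ioo (-ε) ε ⊆ integrableExpSet X μ)
    (hν : Set.Ioo (-ε) ε ⊆ integrableExpSet X ν)
    (h : ∀ t ∈ Set.Ioo (-ε) ε, mgf X μ t = mgf X ν t) :
    complexMGF X μ Complex.I = complexMGF X ν Complex.I := by
  have hpre : IsPreconnected {z : ℂ | z.re ∈ Set.Ioo (-ε) ε} :=
    ((convex_Ioo (-ε) ε).linear_preimage Complex.reLm).isPreconnected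
  have hsub : ∀ {ρ : Measure Ω}, Set.Ioo (-ε) ε ⊆ integrableExpSet X ρ →
      {z : ℂ | z.re ∈ Set.Ioo (-ε) ε} ⊆ {z | z.re ∈ interior (integrableExpSet X ρ)} :=
    fun hρ z hz => interior_maximal hρ isOpen_Ioo hz
  refine AnalyticOnNhd.eqOn_of_preconnected_of_frequently_eq
    (analyticOnNhd_complexMGF.mono (hsub hμ)) (analyticOnNhd_complexMGF.mono (hsub hν)) hpre
    (z₀ := ((0 : ℝ) : ℂ)) (by simp [hε]) ?_ (by simp [hε])
  have htend : Tendsto ((↑) : ℝ → ℂ) (𝓝[≠] (0 : ℝ)) (𝓝[≠] ((0 : ℝ) : ℂ)) :=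
    Complex.continuous_ofReal.continuousAt.tendsto.inf
      (tendsto_principal_principal.2 fun t ht => by simpa using ht)
  refine htend.frequently (Eventually.frequently ?_)
  filter_upwards [nhdsWithin_le_nhds (Ioo_mem_nhds (neg_lt_zero.2 hε) hε)] with t ht
  rw [complexMGF_ofReal, complexMGF_ofReal, h t ht]

variable {V : Type*} [NormedAddCommGroup V] [NormedSpace ℝ V] [FiniteDimensional ℝ V]
  [MeasurableSpace V] [BorelSpace V]

/-- The complex generating function of `z` at `I` is the characteristic function at `z`, which
determines a finite measure. The radius ε may depend on `z`. -/
theorem measure_eq_of_mgf_eq {μ ν : Measure V} [IsFiniteMeasure μ] [IsFiniteMeasure ν]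
    (h : ∀ z : StrongDual ℝ V, ∃ ε > 0, Set.Ioo (-ε) ε ⊆ integrableExpSet z μ ∧
      Set.Ioo (-ε) ε ⊆ integrableExpSet z ν ∧
      ∀ t ∈ Set.Ioo (-ε) ε, mgf z μ t = mgf z ν t) : μ = ν := by
  have : CompleteSpace V := FiniteDimensional.complete ℝ V
  refine Measure.ext_of_charFunDual (funext fun z => ?_)
  obtain ⟨ε, hε, h1, h2, h3⟩ := h z
  have := complexMGF_I_eq_of_mgf_eq hε h1 h2 h3
  simp only [complexMGF] at this
  rw [charFunDual_apply, charFunDual_apply]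
  simpa only [mul_comm] using this

/-- Injectivity of the Laplace transform: a function whose Laplace transform converges and
vanishes on a nonempty open set is zero almost everywhere. -/
theorem ae_eq_zero_of_laplace_eq_zero {μ : Measure V} {g : V → ℝ} {U : Set (StrongDual ℝ V)}
    (hU : IsOpen U) (hne : U.Nonempty)
    (hint : ∀ y ∈ U, Integrable (fun h => Real.exp (-(y h)) * g h) μ)
    (h0 : ∀ y ∈ U, ∫ h, Real.exp (-(y h)) * g h ∂μ = 0) : g =ᵐ[μ] 0 := by
  obtain ⟨y, hy⟩ := hne
  set G : V → ℝ := fun h => Real.exp (-(y h)) * g h with hG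
  have hGi : Integrable G μ := hint y hy
  have hm : AEMeasurable (fun h => ENNReal.ofReal (G h)) μ := hGi.aemeasurable.ennreal_ofReal
  have hm' : AEMeasurable (fun h => ENNReal.ofReal (-G h)) μ :=
    hGi.aemeasurable.neg.ennreal_ofReal
  have : IsFiniteMeasure (μ.withDensity fun h => ENNReal.ofReal (G h)) :=
    isFiniteMeasure_withDensity_ofReal hGi.2
  have : IsFiniteMeasure (μ.withDensity fun h => ENNReal.ofReal (-G h)) :=
    isFiniteMeasure_withDensity_ofReal hGi.neg.2
  -- The generating functions of these two measures in the direction `z` differ at `t` by the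
  -- Laplace transform of `g` at `y - t • z`, which vanishes as long as that point stays in `U`.
  have key : (μ.withDensity fun h => ENNReal.ofReal (G h)) =
      μ.withDensity fun h => ENNReal.ofReal (-G h) := by
    refine measure_eq_of_mgf_eq fun z => ?_
    have hcont : Continuous fun t : ℝ => y - t • z := by fun_prop
    obtain ⟨ε, hε, hball⟩ := Metric.isOpen_iff.1 (hU.preimage hcont) 0 (by simpa using hy)
    rw [Real.ball_eq_Ioo, zero_sub, zero_add] at hball
    have hexp : ∀ (t : ℝ) (h : V),
        Real.exp (t * z h) * G h = Real.exp (-((y - t • z) h)) * g h := by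
      intro t h
      rw [hG, ← mul_assoc, ← Real.exp_add]
      congr 2
      simp only [sub_apply, smul_apply, smul_eq_mul]
      ring
    have hti : ∀ t ∈ Set.Ioo (-ε) ε, Integrable (fun h => Real.exp (t * z h) * G h) μ :=
      fun t ht => by simpa only [hexp] using hint _ (hball ht)
    -- Multiplication by a positive exponential commutes with taking the positive part.
    have hp : ∀ t h, (ENNReal.ofReal (G h)).toReal • Real.exp (t * z h) =
        max (Real.exp (t * z h) * G h) 0 := fun t h => by
      rw [ENNReal.toReal_ofReal', smul_eq_mul, mul_comm, mul_max_of_nonneg _ _ (Real.exp_pos _).le,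
        mul_zero]
    have hn : ∀ t h, (ENNReal.ofReal (-G h)).toReal • Real.exp (t * z h) =
        max (-(Real.exp (t * z h) * G h)) 0 := fun t h => by
      rw [ENNReal.toReal_ofReal', smul_eq_mul, mul_comm, mul_max_of_nonneg _ _ (Real.exp_pos _).le,
        mul_zero, mul_neg]
    refine ⟨ε, hε, fun t ht => ?_, fun t ht => ?_, fun t ht => ?_⟩
    · rw [integrableExpSet, Set.mem_ofPred_eq,
        integrable_withDensity_iff_integrable_smul₀' hm (by simp)]
      simp only [hp]
      exact (hti t ht).pos_part
    · rw [integrableExpSet, Set.mem_ofPred_eq,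
        integrable_withDensity_iff_integrable_smul₀' hm' (by simp)]
      simp only [hn]
      exact (hti t ht).neg_part
    · rw [mgf, mgf, integral_withDensity_eq_integral_toReal_smul₀ hm (by simp),
        integral_withDensity_eq_integral_toReal_smul₀ hm' (by simp)]
      simp only [hp, hn]
      rw [← sub_eq_zero, ← integral_sub (hti t ht).pos_part (hti t ht).neg_part]
      have : ∀ h, max (Real.exp (t * z h) * G h) 0 - max (-(Real.exp (t * z h) * G h)) 0 =
          Real.exp (-((y - t • z) h)) * g h := fun h => by
        rw [← hexp]
        exact max_zero_sub_eq_self _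
      simp only [this]
      exact h0 _ (hball ht)
  rw [withDensity_eq_iff hm hm' hGi.lintegral_lt_top.ne] at key
  filter_upwards [key] with h hh
  -- One of `G h`, `-G h` is nonpositive, so its truncation is 0, and equality of the truncations
  -- makes the other 0 as well.
  have hG0 : G h = 0 := by
    rcases le_total (G h) 0 with hle | hle
    · rw [ENNReal.ofReal_of_nonpos hle, eq_comm, ENNReal.ofReal_eq_zero] at hh
      linarith
    · rw [ENNReal.ofReal_of_nonpos (neg_nonpos.2 hle), ENNReal.ofReal_eq_zero] at hh
      linarith
  simpa [hG, (Real.exp_pos _).ne'] using hG0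

end LaplaceUniqueness

/-! ### Top-degree forms, orientation and contraction -/

section Forms

variable {V : Type*} [NormedAddCommGroup V] [NormedSpace ℝ V] {r : ℕ} {Δ : Finset V}

theorem isPositiveForm_smul_iff {o : Orientation ℝ V (Fin r)} {dh₀ : V [⋀^Fin r]→ₗ[ℝ] ℝ}
    (h₀ : IsPositiveForm o dh₀) {c : ℝ} (hc : c ≠ 0) : IsPositiveForm o (c • dh₀) ↔ 0 < c := by
  obtain ⟨hne, rfl⟩ := h₀
  rw [← sameRay_smul_left_iff_of_ne hne hc]
  constructor
  · rintro ⟨h, h'⟩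
    exact (ray_eq_iff _ _).1 h'
  · exact fun h => ⟨smul_ne_zero hc hne, (ray_eq_iff _ _).2 h⟩

theorem exists_isPositiveForm (o : Orientation ℝ V (Fin r)) :
    ∃ dh : V [⋀^Fin r]→ₗ[ℝ] ℝ, IsPositiveForm o dh := by
  induction o using Module.Ray.ind with
  | _ dh h => exact ⟨dh, h, rfl⟩

theorem contract_smul (c : ℝ) (dh : V [⋀^Fin r]→ₗ[ℝ] ℝ)
    (Φ : GDelta Δ ⊗[ℝ] (⋀[ℝ]^r V)) : contract Δ (c • dh) Φ = c • contract Δ dh Φ := by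
  rw [contract, contract, map_smul, LinearMap.lTensor_smul]
  simp

theorem contract_rTensor (dh : V [⋀^Fin r]→ₗ[ℝ] ℝ) (f : GDelta Δ →ₗ[ℝ] GDelta Δ)
    (Φ : GDelta Δ ⊗[ℝ] (⋀[ℝ]^r V)) :
    contract Δ dh (LinearMap.rTensor (⋀[ℝ]^r V) f Φ) = f (contract Δ dh Φ) := by
  induction Φ using TensorProduct.induction_on with
  | zero => simp
  | add a b ha hb => simp only [map_add, ha, hb]
  | tmul g w => simp [contract]

theorem laplaceIntegrand_add (F G : regPrimal Δ → ℝ) (y : StrongDual ℝ V) :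
    laplaceIntegrand (F + G) y = laplaceIntegrand F y + laplaceIntegrand G y := by
  ext h
  simp only [laplaceIntegrand, Pi.add_apply]
  split_ifs <;> simp [mul_add]

theorem laplaceIntegrand_smul (c : ℝ) (F : regPrimal Δ → ℝ) (y : StrongDual ℝ V) :
    laplaceIntegrand (c • F) y = c • laplaceIntegrand F y := by
  ext h
  simp only [laplaceIntegrand, Pi.smul_apply, smul_eq_mul]
  split_ifs
  · ring
  · simp

variable [FiniteDimensional ℝ V] [Fact (Module.finrank ℝ V = r)]

theorem exists_eq_smul_form {dh₀ : V [⋀^Fin r]→ₗ[ℝ] ℝ} (h₀ : dh₀ ≠ 0)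
    (dh : V [⋀^Fin r]→ₗ[ℝ] ℝ) : ∃ c : ℝ, dh = c • dh₀ := by
  let b := finBasisOfFinrankEq ℝ V (Fact.out : Module.finrank ℝ V = r)
  have hb : dh₀ b ≠ 0 := (AlternatingMap.map_basis_ne_zero_iff b dh₀).2 h₀
  refine ⟨dh b / dh₀ b, ?_⟩
  calc dh = dh b • b.det := dh.eq_smul_basis_det b
    _ = (dh b / dh₀ b) • dh₀ b • b.det := by rw [smul_smul, div_mul_cancel₀ _ hb]
    _ = (dh b / dh₀ b) • dh₀ := by rw [← dh₀.eq_smul_basis_det b]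

/-- `∧^r V` has dimension `r.choose r = 1`, so the nonzero functional defined by `dh` identifies it
with ℝ. -/
theorem contract_bijective {dh : V [⋀^Fin r]→ₗ[ℝ] ℝ} (h : dh ≠ 0) :
    Function.Bijective (contract Δ dh) := by
  have hr : Module.finrank ℝ V = r := Fact.out
  have : IsSimpleModule ℝ (⋀[ℝ]^r V) := by
    rw [isSimpleModule_iff_finrank_eq_one, exteriorPower.finrank_eq, hr, Nat.choose_self]
  have hb : Function.Bijective (exteriorPower.alternatingMapLinearEquiv dh) :=
    LinearMap.bijective_of_ne_zero (by simpa using h)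
  exact (TensorProduct.rid ℝ (GDelta Δ)).bijective.comp
    (LinearEquiv.lTensor (GDelta Δ) (LinearEquiv.ofBijective _ hb)).bijective

end Forms

/-! ### The Laplace transform as a linear isomorphism -/

section LaplaceTransform

variable {V : Type*} [NormedAddCommGroup V] [NormedSpace ℝ V] [FiniteDimensional ℝ V]
  [MeasurableSpace V] [BorelSpace V] {r : ℕ} [Fact (Module.finrank ℝ V = r)]
  {Δ : Finset V} {δ : Set (StrongDual ℝ V)}

theorem formMeasure_compl_regPrimal (Δ : Finset V) (dh : V [⋀^Fin r]→ₗ[ℝ] ℝ) :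
    dh.measure (regPrimal Δ)ᶜ = 0 := by
  rw [AlternatingMap.measure, Measure.smul_apply, measure_compl_regPrimal, smul_zero]

theorem formMeasure_smul (c : ℝ) (dh : V [⋀^Fin r]→ₗ[ℝ] ℝ) :
    (c • dh).measure = ‖c‖₊ • dh.measure := by
  rw [AlternatingMap.measure, AlternatingMap.measure, smul_smul, AlternatingMap.smul_apply,
    nnnorm_smul]

theorem orientedIntegral_of_isPositiveForm {o : Orientation ℝ V (Fin r)}
    {dh : V [⋀^Fin r]→ₗ[ℝ] ℝ} (h : IsPositiveForm o dh) (φ : V → ℝ) :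
    orientedIntegral o dh φ = ∫ v, φ v ∂dh.measure := by
  rw [orientedIntegral, if_pos h, one_mul]

/-- The density scales by `|c|` and the orientation supplies the sign of `c`. For `c = 0` the
default sign -1 is harmless because the measure is zero. -/
theorem orientedIntegral_smul {o : Orientation ℝ V (Fin r)} {dh₀ : V [⋀^Fin r]→ₗ[ℝ] ℝ}
    (h₀ : IsPositiveForm o dh₀) (c : ℝ) (φ : V → ℝ) :
    orientedIntegral o (c • dh₀) φ = c * ∫ v, φ v ∂dh₀.measure := by
  have hint : ∫ v, φ v ∂(c • dh₀).measure = |c| * ∫ v, φ v ∂dh₀.measure := by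
    rw [formMeasure_smul, integral_smul_nnreal_measure, NNReal.smul_def, coe_nnnorm,
      Real.norm_eq_abs, smul_eq_mul]
  rw [orientedIntegral, hint]
  rcases lt_trichotomy c 0 with hc | rfl | hc
  · rw [if_neg (fun h => not_lt.2 hc.le ((isPositiveForm_smul_iff h₀ hc.ne).1 h)),
      abs_of_neg hc]
    ring
  · simp
  · rw [if_pos ((isPositiveForm_smul_iff h₀ hc.ne').2 hc), abs_of_pos hc, one_mul]

theorem vol_pos {σ : Finset V} (hσ : IsBasisOf Δ σ) {dh : V [⋀^Fin r]→ₗ[ℝ] ℝ} (h : dh ≠ 0) :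
    0 < vol σ dh := by
  have hr : Module.finrank ℝ V = r := Fact.out
  let e : Fin r ≃ σ := Fintype.equivOfCardEq (by
    rw [Fintype.card_fin, ← hr, finrank_eq_card_basis hσ.basis])
  have h1 : dh (hσ.basis.reindex e.symm) ≠ 0 := (AlternatingMap.map_basis_ne_zero_iff _ dh).2 h
  have h2 : ⇑(hσ.basis.reindex e.symm) = fun i => (e i : V) := by ext i; simp
  rw [vol_eq σ dh e]
  rw [h2] at h1
  exact abs_pos.2 h1

theorem laplaceIntegrand_polyCone {σ : Finset V} (hσ : IsBasisOf Δ σ)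
    (f : SymmetricAlgebra ℝ (StrongDual ℝ V)) (y : StrongDual ℝ V)
    (dh : V [⋀^Fin r]→ₗ[ℝ] ℝ) :
    laplaceIntegrand (polyCone hσ f).1 y =ᵐ[dh.measure]
      (cone σ).indicator fun h => Real.exp (-(y h)) * evalPrimal h f := by
  have h := measure_eq_zero_iff_ae_notMem.1 (formMeasure_compl_regPrimal Δ dh)
  filter_upwards [h] with v hv
  rw [Set.notMem_compl_iff] at hv
  by_cases hc : v ∈ cone σ <;> simp [laplaceIntegrand, hv, polyCone, polyConeFun, hc]

/-- `φ ∈ R_Δ` is the Laplace transform on `δ` of `F` with respect to the density `|dh|`. -/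
def HasLaplace (dh : V [⋀^Fin r]→ₗ[ℝ] ℝ) (δ : Set (StrongDual ℝ V)) (F : regPrimal Δ → ℝ)
    (φ : RDelta Δ) : Prop :=
  ∀ y : regDual Δ, (y : StrongDual ℝ V) ∈ δ →
    Integrable (laplaceIntegrand F (y : StrongDual ℝ V)) dh.measure ∧
      ∫ h, laplaceIntegrand F (y : StrongDual ℝ V) h ∂dh.measure = evalR y φ

namespace HasLaplace

variable {dh : V [⋀^Fin r]→ₗ[ℝ] ℝ} {F G : regPrimal Δ → ℝ} {φ ψ : RDelta Δ}

theorem zero : HasLaplace dh δ (0 : regPrimal Δ → ℝ) 0 := by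
  intro y _
  have : laplaceIntegrand (0 : regPrimal Δ → ℝ) (y : StrongDual ℝ V) = 0 := by
    ext h; simp [laplaceIntegrand]
  rw [this]
  exact ⟨integrable_zero _ _ _, by simp⟩

theorem add (hF : HasLaplace dh δ F φ) (hG : HasLaplace dh δ G ψ) :
    HasLaplace dh δ (F + G) (φ + ψ) := by
  intro y hy
  obtain ⟨h1, h2⟩ := hF y hy
  obtain ⟨h3, h4⟩ := hG y hy
  rw [laplaceIntegrand_add]
  exact ⟨h1.add h3, by rw [integral_add' h1 h3, h2, h4, map_add]⟩

theorem smul (c : ℝ) (hF : HasLaplace dh δ F φ) : HasLaplace dh δ (c • F) (c • φ) := by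
  intro y hy
  obtain ⟨h1, h2⟩ := hF y hy
  rw [laplaceIntegrand_smul]
  refine ⟨h1.smul c, ?_⟩
  simp only [Pi.smul_apply]
  rw [integral_smul, h2, map_smul]

theorem unique (hδ : IsChamber Δ δ) (hφ : HasLaplace dh δ F φ) (hψ : HasLaplace dh δ F ψ) :
    φ = ψ := by
  rw [← sub_eq_zero]
  refine eq_zero_of_evalR_eq_zero hδ.isOpen hδ.nonempty hδ.subset fun y hy => ?_
  rw [map_sub, ← (hφ y hy).2, ← (hψ y hy).2, sub_self]

theorem polyCone (hδ : IsChamber Δ δ) {σ : Finset V} (hσ : IsBasisOf Δ σ)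
    (hc : cone σ ⊆ dualCone δ) (f : SymmetricAlgebra ℝ (StrongDual ℝ V)) :
    HasLaplace dh δ (polyCone hσ f).1 (vol σ dh • diffOp Δ (negSubst f) (phi Δ σ)) := by
  intro y hy
  have hae := laplaceIntegrand_polyCone hσ f y dh
  obtain ⟨h1, h2⟩ := integral_cone hσ dh y
    (fun α hα => hδ.pos_of_cone_subset hσ.subset hc hy hα) f
  refine ⟨h1.congr hae.symm, ?_⟩
  rw [integral_congr_ae hae, h2, map_smul, smul_eq_mul]

theorem eq_zero (hδ : IsChamber Δ δ) (hdh : dh ≠ 0) {F : LocPoly Δ}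
    (hF : HasLaplace dh δ F.1 0) : F = 0 := by
  -- The integrand at `y` is `e^{-y}` times the integrand at 0, which is `F` extended by zero across
  -- the walls.
  have h0 : ∀ h : V, ∀ y : StrongDual ℝ V, laplaceIntegrand F.1 y h =
      Real.exp (-(y h)) * laplaceIntegrand F.1 0 h := fun h y => by
    simp only [laplaceIntegrand]
    split_ifs <;> simp
  have hae : laplaceIntegrand F.1 (0 : StrongDual ℝ V) =ᵐ[dh.measure] 0 := by
    refine ae_eq_zero_of_laplace_eq_zero hδ.isOpen hδ.nonempty (fun y hy => ?_) fun y hy => ?_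
    · simpa only [← h0] using (hF ⟨y, hδ.subset hy⟩ hy).1
    · simpa only [← h0, map_zero] using (hF ⟨y, hδ.subset hy⟩ hy).2
  -- By continuity the nonvanishing locus is open in `V`; being null for a nonzero multiple of Haar
  -- measure, it is empty.
  set U : Set V := (↑) '' {h : regPrimal Δ | F.1 h ≠ 0} with hU
  have hUo : IsOpen U := (isOpen_regPrimal Δ).isOpenMap_subtype_val _
    (isOpen_ne_fun (LocPoly.continuous F) continuous_const)
  have hUnull : dh.measure U = 0 := by
    refine measure_mono_null ?_ (ae_iff.1 hae)
    rintro _ ⟨h, hh, rfl⟩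
    simpa [laplaceIntegrand] using hh
  have hUe : U = ∅ := by
    let b := finBasisOfFinrankEq ℝ V (Fact.out : Module.finrank ℝ V = r)
    have hb : ‖dh b‖₊ ≠ 0 := nnnorm_ne_zero_iff.2
      ((AlternatingMap.map_basis_ne_zero_iff b dh).2 hdh)
    rw [AlternatingMap.measure, Measure.smul_apply] at hUnull
    exact (hUo.measure_eq_zero_iff b.addHaar).1 ((smul_eq_zero.1 hUnull).resolve_left hb)
  ext h
  by_contra hne
  have : (h : V) ∈ U := ⟨h, hne, rfl⟩
  rw [hUe] at this
  exact this

end HasLaplace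

theorem exists_hasLaplace (hδ : IsChamber Δ δ) (dh : V [⋀^Fin r]→ₗ[ℝ] ℝ)
    (F : ChamberLocPoly Δ δ) : ∃ φ : GDelta Δ, HasLaplace dh δ F.1.1 (φ : RDelta Δ) := by
  obtain ⟨F, hF⟩ := F
  induction hF using Submodule.span_induction with
  | zero => exact ⟨0, HasLaplace.zero⟩
  | add a b _ _ ha hb =>
    obtain ⟨φ, hφ⟩ := ha
    obtain ⟨ψ, hψ⟩ := hb
    exact ⟨φ + ψ, hφ.add hψ⟩
  | smul c a _ ha =>
    obtain ⟨φ, hφ⟩ := ha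
    exact ⟨c • φ, hφ.smul c⟩
  | mem F hF =>
    obtain ⟨f, σ, hσ, hc, rfl⟩ := hF
    exact ⟨⟨_, Submodule.smul_mem _ _ (diffOp_mem_GDelta Δ (negSubst f) _ (phi_mem_GDelta hσ))⟩,
      HasLaplace.polyCone hδ hσ hc f⟩

/-- The Laplace transform on `P_Δ(δ)` with respect to the density `|dh|`. -/
def laplaceMap (hδ : IsChamber Δ δ) (dh : V [⋀^Fin r]→ₗ[ℝ] ℝ) :
    ChamberLocPoly Δ δ →ₗ[ℝ] GDelta Δ where
  toFun F := (exists_hasLaplace hδ dh F).choose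
  map_add' F G := Subtype.ext <| HasLaplace.unique hδ
    (exists_hasLaplace hδ dh (F + G)).choose_spec
    ((exists_hasLaplace hδ dh F).choose_spec.add (exists_hasLaplace hδ dh G).choose_spec)
  map_smul' c F := Subtype.ext <| HasLaplace.unique hδ
    (exists_hasLaplace hδ dh (c • F)).choose_spec
    ((exists_hasLaplace hδ dh F).choose_spec.smul c)

theorem hasLaplace_laplaceMap (hδ : IsChamber Δ δ) (dh : V [⋀^Fin r]→ₗ[ℝ] ℝ)
    (F : ChamberLocPoly Δ δ) : HasLaplace dh δ F.1.1 (laplaceMap hδ dh F : RDelta Δ) :=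
  (exists_hasLaplace hδ dh F).choose_spec

theorem hasLaplace_iff (hδ : IsChamber Δ δ) (dh : V [⋀^Fin r]→ₗ[ℝ] ℝ)
    (F : ChamberLocPoly Δ δ) (φ : GDelta Δ) :
    HasLaplace dh δ F.1.1 (φ : RDelta Δ) ↔ laplaceMap hδ dh F = φ := by
  constructor
  · exact fun h => Subtype.ext ((hasLaplace_laplaceMap hδ dh F).unique hδ h)
  · rintro rfl
    exact hasLaplace_laplaceMap hδ dh F

/-- On a generator, both sides come from `P * f` on the same cone, and `P ↦ P(-∂)` is
multiplicative. -/
theorem laplaceMap_mulChamber (hδ : IsChamber Δ δ) (dh : V [⋀^Fin r]→ₗ[ℝ] ℝ)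
    (P : SymmetricAlgebra ℝ (StrongDual ℝ V)) (F : ChamberLocPoly Δ δ) :
    laplaceMap hδ dh (mulChamber Δ δ P F) = diffG Δ (negSubst P) (laplaceMap hδ dh F) := by
  suffices h : HasLaplace dh δ (mulLocPoly Δ P F.1).1
      (diffOp Δ (negSubst P) (laplaceMap hδ dh F : RDelta Δ)) from
    (hasLaplace_iff hδ dh _ _).1 h
  obtain ⟨F, hF⟩ := F
  suffices h : ∀ φ, HasLaplace dh δ F.1 φ →
      HasLaplace dh δ (mulLocPoly Δ P F).1 (diffOp Δ (negSubst P) φ) from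
    h _ (hasLaplace_laplaceMap hδ dh ⟨F, hF⟩)
  -- By uniqueness one transform `φ` suffices, and this existential form passes through sums and
  -- multiples in the span induction.
  suffices h : ∃ φ, HasLaplace dh δ F.1 φ ∧
      HasLaplace dh δ (mulLocPoly Δ P F).1 (diffOp Δ (negSubst P) φ) by
    obtain ⟨ψ, h1, h2⟩ := h
    intro φ hφ
    rwa [hφ.unique hδ h1]
  induction hF using Submodule.span_induction with
  | zero => exact ⟨0, HasLaplace.zero, by rw [map_zero, map_zero]; exact HasLaplace.zero⟩
  | add a b _ _ ha hb =>
    obtain ⟨φ, h1, h2⟩ := ha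
    obtain ⟨ψ, h3, h4⟩ := hb
    exact ⟨φ + ψ, h1.add h3, by rw [map_add, map_add]; exact h2.add h4⟩
  | smul c a _ ha =>
    obtain ⟨φ, h1, h2⟩ := ha
    exact ⟨c • φ, h1.smul c, by rw [map_smul, map_smul]; exact h2.smul c⟩
  | mem F hF =>
    obtain ⟨f, σ, hσ, hc, rfl⟩ := hF
    refine ⟨_, HasLaplace.polyCone hδ hσ hc f, ?_⟩
    have hmul : mulLocPoly Δ P (polyCone hσ f) = polyCone hσ (P * f) := by
      ext h
      simp [mulLocPoly, polyCone, polyConeFun]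
    rw [hmul, map_smul, ← Module.End.mul_apply, ← map_mul, ← map_mul]
    exact HasLaplace.polyCone hδ hσ hc (P * f)

theorem laplaceMap_bijective (h_symm : ∀ α ∈ Δ, -α ∈ Δ) (hδ : IsChamber Δ δ)
    {dh : V [⋀^Fin r]→ₗ[ℝ] ℝ} (hdh : dh ≠ 0) : Function.Bijective (laplaceMap hδ dh) := by
  constructor
  · rw [injective_iff_map_eq_zero]
    intro F hF
    have h := hasLaplace_laplaceMap hδ dh F
    rw [hF] at h
    exact Subtype.ext (h.eq_zero hδ hdh)
  · rintro ⟨φ, hφ⟩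
    obtain ⟨y, hy⟩ := hδ.nonempty
    suffices h : ∃ F, (laplaceMap hδ dh F : RDelta Δ) = φ by
      obtain ⟨F, hF⟩ := h
      exact ⟨F, Subtype.ext hF⟩
    have hφ' := GDelta_le_span_diffOp_phi h_symm (hδ.subset hy) hφ
    clear hφ
    induction hφ' using Submodule.span_induction with
    | zero => exact ⟨0, by simp⟩
    | add a b _ _ ha hb =>
      obtain ⟨F, rfl⟩ := ha
      obtain ⟨G, rfl⟩ := hb
      exact ⟨F + G, by simp⟩
    | smul c a _ ha =>
      obtain ⟨F, rfl⟩ := ha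
      exact ⟨c • F, by simp⟩
    | mem φ hφ =>
      obtain ⟨f, σ, hσ, hpos, rfl⟩ := hφ
      have hc := hδ.cone_subset_of_pos hσ.subset hy hpos
      refine ⟨(vol σ dh)⁻¹ • ⟨polyCone hσ f, Submodule.subset_span ⟨f, σ, hσ, hc, rfl⟩⟩, ?_⟩
      refine (hasLaplace_laplaceMap hδ dh _).unique hδ ?_
      have h := (HasLaplace.polyCone (dh := dh) hδ hσ hc f).smul (vol σ dh)⁻¹
      rwa [inv_smul_smul₀ (vol_pos hσ hdh).ne'] at h

/-- Every top form is a multiple of `dh₀`, and the oriented integral and the contraction are both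
homogeneous in the form, so the condition need only be tested on `dh₀`. -/
theorem isLaplaceTransform_iff {o : Orientation ℝ V (Fin r)} {dh₀ : V [⋀^Fin r]→ₗ[ℝ] ℝ}
    (h₀ : IsPositiveForm o dh₀) (F : ChamberLocPoly Δ δ) (Φ : GDelta Δ ⊗[ℝ] (⋀[ℝ]^r V)) :
    IsLaplaceTransform o F Φ ↔ HasLaplace dh₀ δ F.1.1 (contract Δ dh₀ Φ : RDelta Δ) := by
  constructor
  · intro h y hy
    obtain ⟨h1, h2⟩ := h dh₀ y hy
    exact ⟨h1, by rw [← h2, orientedIntegral_of_isPositiveForm h₀]⟩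
  · intro h dh y hy
    obtain ⟨c, rfl⟩ := exists_eq_smul_form h₀.1 dh
    obtain ⟨h1, h2⟩ := h y hy
    rw [formMeasure_smul, orientedIntegral_smul h₀, h2, contract_smul]
    exact ⟨h1.smul_measure_nnreal, by simp⟩

end LaplaceTransform

end HypArr

end

open HypArr MeasureTheory

open scoped TensorProduct
theorem mainTheorem7 {V : Type*} [NormedAddCommGroup V] [NormedSpace ℝ V] [FiniteDimensional ℝ V]
    [MeasurableSpace V] [BorelSpace V] {r : ℕ} [Fact (Module.finrank ℝ V = r)]
    (o : Orientation ℝ V (Fin r))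
    (Δ : Finset V) (h_zero : (0 : V) ∉ Δ) (h_span : Submodule.span ℝ (Δ : Set V) = ⊤)
    (h_symm : ∀ α ∈ Δ, -α ∈ Δ)
    (δ : Set (StrongDual ℝ V)) (hδ : IsChamber Δ δ) :
    (∃ L : ChamberLocPoly Δ δ ≃ₗ[ℝ] (GDelta Δ ⊗[ℝ] (⋀[ℝ]^r V)),
      (∀ (F : ChamberLocPoly Δ δ) (Φ : GDelta Δ ⊗[ℝ] (⋀[ℝ]^r V)),
        IsLaplaceTransform o F Φ ↔ L F = Φ) ∧
      (∀ (P : SymmetricAlgebra ℝ (StrongDual ℝ V)) (F : ChamberLocPoly Δ δ),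
        L (mulChamber Δ δ P F) =
          LinearMap.rTensor (⋀[ℝ]^r V) (diffG Δ (negSubst P)) (L F)) ∧
      (∀ (dh : V [⋀^Fin r]→ₗ[ℝ] ℝ), IsPositiveForm o dh →
        ∀ (σ : Finset V) (hσ : IsBasisOf Δ σ) (hc : cone σ ⊆ dualCone δ),
          (contract Δ dh (L (coneIndicator hσ hc)) : RDelta Δ) = vol σ dh • phi Δ σ)) ∧
    (∀ (dh : V [⋀^Fin r]→ₗ[ℝ] ℝ), IsPositiveForm o dh →
      ∀ (σ : Finset V), IsBasisOf Δ σ → cone σ ⊆ dualCone δ →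
        ∀ y : regDual Δ, (y : StrongDual ℝ V) ∈ δ →
          IntegrableOn (fun h : V => Real.exp (-((y : StrongDual ℝ V) h))) (cone σ) dh.measure ∧
          orientedIntegral o dh
              ((cone σ).indicator fun h : V => Real.exp (-((y : StrongDual ℝ V) h))) =
            vol σ dh * evalR y (phi Δ σ)) := by
  refine ⟨?_, fun dh hdh σ hσ hc y hy => ?_⟩
  · obtain ⟨dh₀, h₀⟩ := exists_isPositiveForm o
    -- The required map is the transform for `|dh₀|` followed by the inverse of contraction with
    -- `dh₀`.
    let e := LinearEquiv.ofBijective (contract (r := r) Δ dh₀) (contract_bijective h₀.1)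
    let M := LinearEquiv.ofBijective (laplaceMap hδ dh₀) (laplaceMap_bijective h_symm hδ h₀.1)
    have he : ∀ F, contract Δ dh₀ ((M.trans e.symm) F) = laplaceMap hδ dh₀ F :=
      fun F => e.apply_symm_apply _
    have hL : ∀ (F : ChamberLocPoly Δ δ) (Φ : GDelta Δ ⊗[ℝ] (⋀[ℝ]^r V)),
        IsLaplaceTransform o F Φ ↔ (M.trans e.symm) F = Φ := fun F Φ => by
      rw [isLaplaceTransform_iff h₀, hasLaplace_iff hδ, ← he, (contract_bijective h₀.1).1.eq_iff]
    refine ⟨M.trans e.symm, hL, fun P F => ?_, fun dh hdh σ hσ hc => ?_⟩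
    · apply (contract_bijective h₀.1).1
      rw [contract_rTensor, he, he, laplaceMap_mulChamber]
    -- The characterization `hL` does not involve `dh₀`, so it can be tested against any other
    -- positive form.
    · refine ((isLaplaceTransform_iff hdh _ _).1 ((hL (coneIndicator hσ hc) _).2 rfl)).unique hδ ?_
      have h := HasLaplace.polyCone (dh := dh) hδ hσ hc 1
      rwa [map_one, map_one, Module.End.one_apply] at h
  · obtain ⟨h1, h2⟩ := integral_cone hσ dh y
      (fun α hα => hδ.pos_of_cone_subset hσ.subset hc hy hα) 1
    simp only [map_one, mul_one, Module.End.one_apply] at h1 h2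
    -- The cone is a finite intersection of closed coordinate half-spaces; measurability turns
    -- integrability of the indicator into integrability on the cone.
    have hm : MeasurableSet (cone σ) := by
      have h := mem_cone_iff hσ.basis hσ.basis_apply
      have : cone σ = ⋂ i, hσ.basis.equivFunL ⁻¹' {x | 0 ≤ x i} := by
        ext v
        simpa using h v
      rw [this]
      exact MeasurableSet.iInter fun i => (isClosed_le continuous_const
        (continuous_apply i)).measurableSet.preimage hσ.basis.equivFunL.continuous.measurable
    exact ⟨(integrable_indicator_iff hm).1 h1,
      by rw [orientedIntegral_of_isPositiveForm hdh, h2]⟩
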